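/- Notation. For $p\in\mathbb R^3$ let $p^0=\sqrt{1+|p|^2}$ and $p^\mu=(p^0,p)$. For four-vectors let $x^\mu y_\mu=-x^0y^0+\sum_{i=1}^3x^iy^i$, $g(x^\mu,y^\mu)=\sqrt{(x^\mu-y^\mu)(x_\mu-y_\mu)}$ and $s(x^\mu,y^\mu)=-(x^\mu+y^\mu)(x_\mu+y_\mu)$. An energy-momentum vector is a four-vector $a^\mu$ with $a^\mu a_\mu=-1$ and $a^0>0$. Let $\|f\|_{L^1_1}=\int_{\mathbb R^3}p^0|f(p)|\,dp$, and let $L^1_1(\mathbb R^3)$ be the space of measurable $f$ with $\|f\|_{L^1_1}<\infty$. For nonnegative $f$ the gain operator is $$Q^+(f,f)(p)=\frac1{p^0}\int_{\mathbb R^3}\frac{dq}{q^0}\int_{\mathbb R^3}\frac{dq'}{q'^0}\int_{\mathbb R^3}\frac{dp'}{p'^0}\;\frac12\,s\,\sigma(g,\theta)\,\delta^{(4)}(p^\mu+q^\mu-p'^\mu-q'^\mu)\,f(p')f(q'),$$ where $s=s(p^\mu,q^\mu)$, $g=g(p^\mu,q^\mu)$ and $\theta\in[0,\pi]$ is given by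 $\cos\theta=(p^\mu-q^\mu)(p'_\mu-q'_\mu)/g^2$. Here, for each $p$, the expression $\delta^{(4)}(p^\mu+q^\mu-p'^\mu-q'^\mu)\frac{dq}{q^0}\frac{dq'}{q'^0}\frac{dp'}{p'^0}$ denotes the measure on triples $(q,q',p')$ that is obtained by replacing $\delta^{(4)}$ by the normalised indicator functions of balls of radius $\varepsilon$ about the origin of $\mathbb R^4$ and letting $\varepsilon\to0$, as a limit of measures tested against continuous functions with compact support. Proposition (potential type estimate). For every $p\in\mathbb R^3$ the measure just described exists and is unique, so that $Q^+$ is well defined. Moreover, for all constants $c_1,c_2>0$ there is a constant $C>0$, depending only on $c_1$ and $c_2$, such that the following holds. Let $\sigma$ be a measurable scattering kernel with $c_1g\le\sigma(g,\theta)\le c_2g$ for all $g>0$ and $\theta\in[0,\pi]$. Then for every nonnegative $f\in L^1_1(\mathbb R^3)$ and every energy-momentum vector $a^\mu$, $$\int_{\mathbb R^3}\frac{(p^0)^{1/2}}{g(p^\mu,a^\mu)}\,Q^+(f,f)(p)\,dp\le C\,\sqrt{a^0}\,\|f\|_{L^1_1}^2 .$$ -/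

import Mathlib

open MeasureTheory Filter Topology
open scoped ENNReal

namespace RelBoltzmann

noncomputable section

/-- Momentum space `ℝ³` with its Euclidean norm. -/
abbrev Momentum : Type := EuclideanSpace ℝ (Fin 3)

/-- Four-vectors `x^μ = (x⁰, x)` with `x⁰ ∈ ℝ` and `x ∈ ℝ³`. The measure `volume` on this type is
four-dimensional Lebesgue measure. -/
abbrev FourVector : Type := ℝ × Momentum

/-- Lorentz inner product `x^μ y_μ = -x⁰ y⁰ + x · y`. -/
def lorentz (x y : FourVector) : ℝ := -(x.1 * y.1) + inner ℝ x.2 y.2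

/-- Energy-momentum vectors: `a^μ a_μ = -1` and `a⁰ > 0`. -/
def IsEnergyMomentum (a : FourVector) : Prop := lorentz a a = -1 ∧ 0 < a.1

/-- The energy `p⁰ = √(1 + |p|²)` of a particle with momentum `p`. -/
def energy (p : Momentum) : ℝ := Real.sqrt (1 + ‖p‖ ^ 2)

/-- The energy-momentum vector `p^μ = (p⁰, p)` of a particle with momentum `p`. -/
def fourMomentum (p : Momentum) : FourVector := (energy p, p)

/-- `s(x^μ, y^μ) = -(x^μ + y^μ)(x_μ + y_μ)`. -/
def sInv (x y : FourVector) : ℝ := -lorentz (x + y) (x + y)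

/-- The relative momentum `g(x^μ, y^μ) = √((x^μ - y^μ)(x_μ - y_μ))`. -/
def relMomentum (x y : FourVector) : ℝ := Real.sqrt (lorentz (x - y) (x - y))

/-- The scattering angle `θ ∈ [0, π]`, with
`cos θ = (p^μ - q^μ)(p'_μ - q'_μ) / g²` and `g = g(p^μ, q^μ)`. -/
def scatteringAngle (p q p' q' : Momentum) : ℝ :=
  Real.arccos
    (lorentz (fourMomentum p - fourMomentum q) (fourMomentum p' - fourMomentum q') /
      relMomentum (fourMomentum p) (fourMomentum q) ^ 2)

/-- `ν` is the measure `δ(Φ(x)) dμ(x)`, with `δ` the Dirac delta at the origin of `V`: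
`δ` is replaced by the normalised indicator functions of the balls of radius `ε` about `0`, and
`ν` is the limit of the resulting measures as `ε → 0`, tested against continuous functions with
compact support. -/
def IsDeltaMeasure {X V : Type*} [TopologicalSpace X] [MeasurableSpace X]
    [NormedAddCommGroup V] [MeasureSpace V]
    (μ : Measure X) (Φ : X → V) (ν : Measure X) : Prop :=
  IsFiniteMeasureOnCompacts ν ∧
    ∀ φ : X → ℝ, Continuous φ → HasCompactSupport φ →
      Tendsto
        (fun ε : ℝ =>
          (volume.real (Metric.ball (0 : V) ε))⁻¹ * ∫ x in {x | ‖Φ x‖ < ε}, φ x ∂μ)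
        (𝓝[>] 0) (𝓝 (∫ x, φ x ∂ν))

/-- There is at most one measure `δ(Φ(x)) dμ(x)`. -/
theorem IsDeltaMeasure.unique {X V : Type*} [MetricSpace X] [ProperSpace X] [MeasurableSpace X]
    [BorelSpace X] [NormedAddCommGroup V] [MeasureSpace V]
    {μ : Measure X} {Φ : X → V} {ν ν' : Measure X}
    (h : IsDeltaMeasure μ Φ ν) (h' : IsDeltaMeasure μ Φ ν') : ν = ν' := by
  have := h.1
  have := h'.1
  refine Measure.ext_of_integral_eq_on_compactlySupported (fun φ => ?_)
  exact tendsto_nhds_unique (h.2 φ φ.continuous φ.hasCompactSupport)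
    (h'.2 φ φ.continuous φ.hasCompactSupport)

open Classical in
/-- The measure `δ(Φ(x)) dμ(x)` (and the zero measure if there is no such measure). -/
def deltaMeasure {X V : Type*} [TopologicalSpace X] [MeasurableSpace X]
    [NormedAddCommGroup V] [MeasureSpace V]
    (μ : Measure X) (Φ : X → V) : Measure X :=
  if h : ∃ ν, IsDeltaMeasure μ Φ ν then h.choose else 0

/-- The measure `dp / p⁰` on momentum space. -/
def shellMeasure : Measure Momentum :=
  volume.withDensity (fun p => ENNReal.ofReal (1 / energy p))

instance : SFinite shellMeasure := by
  unfold shellMeasure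
  infer_instance

/-- The measure `(dq / q⁰) (dq' / q'⁰) (dp' / p'⁰)` on the space of triples `(q, q', p')`. -/
def tripleMeasure : Measure (Momentum × Momentum × Momentum) :=
  shellMeasure.prod (shellMeasure.prod shellMeasure)

/-- The defect `p^μ + q^μ - p'^μ - q'^μ` in the conservation of energy and momentum, as a function
of the triple `x = (q, q', p')`. -/
def conservationDefect (p : Momentum) (x : Momentum × Momentum × Momentum) : FourVector :=
  fourMomentum p + fourMomentum x.1 - fourMomentum x.2.2 - fourMomentum x.2.1

/-- The measure
`δ⁽⁴⁾(p^μ + q^μ - p'^μ - q'^μ) (dq / q⁰) (dq' / q'⁰) (dp' / p'⁰)` on triples `(q, q', p')`. -/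
def collisionMeasure (p : Momentum) : Measure (Momentum × Momentum × Momentum) :=
  deltaMeasure tripleMeasure (conservationDefect p)

/-- The gain operator with scattering kernel `σ(g, θ)`, for nonnegative `σ`, `f` and `h`:
`Q⁺(f, h)(p) = (1/p⁰) ∫ dq/q⁰ ∫ dq'/q'⁰ ∫ dp'/p'⁰ W(p, q | p', q') f(p') h(q')` with
`W(p, q | p', q') = (1/2) s σ(g, θ) δ⁽⁴⁾(p^μ + q^μ - p'^μ - q'^μ)`, `s = s(p^μ, q^μ)` and
`g = g(p^μ, q^μ)`. Its values lie in `[0, ∞]`. The variable `x` is `(q, q', p')`. -/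
def gain (σ : ℝ → ℝ → ℝ) (f h : Momentum → ℝ) (p : Momentum) : ℝ≥0∞ :=
  ENNReal.ofReal (1 / energy p) *
    ∫⁻ x, ENNReal.ofReal
      (1 / 2 * sInv (fourMomentum p) (fourMomentum x.1) *
        σ (relMomentum (fourMomentum p) (fourMomentum x.1))
          (scatteringAngle p x.1 x.2.2 x.2.1) *
        f x.2.2 * h x.2.1) ∂(collisionMeasure p)

/-- The weighted norm `‖f‖_{L¹_ρ} = ∫ (p⁰)^ρ |f(p)| dp`, with values in `[0, ∞]`. -/
def weightedL1Norm (ρ : ℝ) (f : Momentum → ℝ) : ℝ≥0∞ :=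
  ∫⁻ p, ENNReal.ofReal (energy p ^ ρ * |f p|)

/-- Membership in the weighted space `L¹_ρ(ℝ³)`. -/
def MemWeightedL1 (ρ : ℝ) (f : Momentum → ℝ) : Prop :=
  AEMeasurable f volume ∧ weightedL1Norm ρ f < ⊤

end

end RelBoltzmann

open RelBoltzmann

open RelBoltzmann

namespace RelBoltzmann

noncomputable section

/-! Two unit-mass particles with total four-momentum P = (E, k) have momenta k/2 ± rω. When E > 0
and the squared mass s exceeds 4, each direction ω determines r, and dp/p⁰ dq/q⁰ = `phaseDensity P
ω` dω dP (`lintegral_shellMeasure_prod`). Applied to the pair (p', q'), this turns the conservation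
defect into an integration variable v. Integrals of test functions over the level sets of the defect
are continuous at v = 0, so their averages over shrinking balls converge to the value at 0; this is
the delta measure (`isDeltaMeasure_explicitCollisionMeasure`).

For the estimate, the pair (p, q) is disintegrated as well. Both pairs share P, so the left-hand
side becomes an integral over P of a product: the angular average of (p⁰)^{1/2} s σ / g(p, a) over
the pairs (p, q), times `pairIntegral`. Since s and g depend on P alone, σ ≤ c₂ g and p⁰ ≤ E, only
the average of 1/g(p, a) matters, and it is bounded by a universal constant
(`lintegral_phaseDensity_div_relMomentum_le`): a linear contraction along the velocity k/E
uniformises the angular density and makes g(p, a)² of the form α + ⟨w, y⟩ with y a unit vector and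
‖w‖ ≤ α. The average of its inverse square root is O(α^{-1/2}), which the prefactor compensates.

What remains is the weight √E s^{3/2} on the pairs (p', q'). It is at most 12 (p'⁰ q'⁰)², and the
measures dp'/p'⁰, dq'/q'⁰ absorb one power each, leaving the square of the L¹₁ norm. The bound is
uniform in a; the factor √a⁰ enters only through a⁰ ≥ 1. -/

lemma energy_pos (p : Momentum) : 0 < energy p := by
  unfold energy; positivity

lemma energy_sq (p : Momentum) : energy p ^ 2 = 1 + ‖p‖ ^ 2 := by
  unfold energy; rw [Real.sq_sqrt (by positivity)]

lemma one_le_energy (p : Momentum) : 1 ≤ energy p := by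
  have := energy_sq p
  nlinarith [energy_pos p, sq_nonneg ‖p‖]

lemma norm_lt_energy (p : Momentum) : ‖p‖ < energy p := by
  have := energy_sq p
  nlinarith [energy_pos p, norm_nonneg p]

lemma energy_eq_of_sq {p : Momentum} {t : ℝ} (ht : 0 ≤ t) (h : 1 + ‖p‖ ^ 2 = t ^ 2) :
    energy p = t := by
  unfold energy; rw [h, Real.sqrt_sq ht]

@[fun_prop]
lemma continuous_energy : Continuous energy := by
  unfold energy; fun_prop

/-! ### Kinematics of a pair with given total four-momentum and direction -/

/-- The squared invariant mass `-P^μ P_μ`. -/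
def massSq (P : FourVector) : ℝ := P.1 ^ 2 - ‖P.2‖ ^ 2

/-- The distance of the momenta of two unit-mass particles with total four-momentum `P` from
their mean `P.2 / 2`, if their difference points in the direction `ω`. -/
def outgoingRadius (P : FourVector) (ω : Momentum) : ℝ :=
  √(massSq P - 4) / 2 * P.1 / √(P.1 ^ 2 - inner ℝ P.2 ω ^ 2)

/-- The density of two-particle phase space in the total four-momentum `P` and the direction `ω`. -/
def phaseDensity (P : FourVector) (ω : Momentum) : ℝ :=
  if 0 < P.1 then √(massSq P - 4) / 2 * P.1 ^ 2 / √(P.1 ^ 2 - inner ℝ P.2 ω ^ 2) ^ 3 else 0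

/-- The momentum of the particle moving in direction `ω` in a pair with total
four-momentum `P`; the other one is `outgoing P (-ω)`. -/
def outgoing (P : FourVector) (ω : Momentum) : Momentum :=
  (1 / 2 : ℝ) • P.2 + outgoingRadius P ω • ω

lemma outgoingRadius_neg (P : FourVector) (ω : Momentum) :
    outgoingRadius P (-ω) = outgoingRadius P ω := by
  simp [outgoingRadius]

lemma phaseDensity_nonneg (P : FourVector) (ω : Momentum) : 0 ≤ phaseDensity P ω := by
  unfold phaseDensity; split_ifs <;> positivity

/-- Singles out the physical region. `Real.sqrt` vanishes at nonpositive arguments, which kills the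
density for s ≤ 4; the case distinction in `phaseDensity` removes the negative-energy cone. -/
lemma pos_of_phaseDensity_ne_zero {P : FourVector} {ω : Momentum} (h : phaseDensity P ω ≠ 0) :
    0 < P.1 ∧ 4 < massSq P := by
  unfold phaseDensity at h
  split_ifs at h with hP
  · refine ⟨hP, ?_⟩
    by_contra! hs
    exact h (by simp [Real.sqrt_eq_zero_of_nonpos (by linarith : massSq P - 4 ≤ 0)])
  · exact absurd rfl h

lemma inner_sq_le {ω : Momentum} (hω : ‖ω‖ = 1) (k : Momentum) : inner ℝ k ω ^ 2 ≤ ‖k‖ ^ 2 := by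
  have := abs_real_inner_le_norm k ω
  rw [hω, mul_one] at this
  exact sq_le_sq' (by linarith [neg_abs_le (inner ℝ k ω)]) (by linarith [le_abs_self (inner ℝ k ω)])

lemma massSq_le {ω : Momentum} (hω : ‖ω‖ = 1) (P : FourVector) :
    massSq P ≤ P.1 ^ 2 - inner ℝ P.2 ω ^ 2 := by
  unfold massSq; linarith [inner_sq_le hω P.2]

lemma outgoingRadius_sq {P : FourVector} {ω : Momentum} (hω : ‖ω‖ = 1) (hs : 4 ≤ massSq P) :
    4 * outgoingRadius P ω ^ 2 * (P.1 ^ 2 - inner ℝ P.2 ω ^ 2) = (massSq P - 4) * P.1 ^ 2 := by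
  have hD : 0 < P.1 ^ 2 - inner ℝ P.2 ω ^ 2 := by linarith [massSq_le hω P]
  unfold outgoingRadius
  rw [div_pow, mul_pow, div_pow, Real.sq_sqrt hD.le, Real.sq_sqrt (by linarith)]
  field_simp
  ring

lemma norm_half_add_smul_sq {ω : Momentum} (hω : ‖ω‖ = 1) (k : Momentum) (r : ℝ) :
    ‖(1 / 2 : ℝ) • k + r • ω‖ ^ 2 = ‖k‖ ^ 2 / 4 + r * inner ℝ k ω + r ^ 2 := by
  rw [norm_add_sq_real, norm_smul, norm_smul, inner_smul_left, inner_smul_right, hω]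
  simp
  ring

/-- Squaring the claimed energy reduces the mass-shell condition for k/2 + Rω to
`outgoingRadius_sq`; the sign of the claimed energy has to be checked separately. -/
lemma energy_outgoing {P : FourVector} {ω : Momentum} (hω : ‖ω‖ = 1) (hP : 0 < P.1)
    (hs : 4 ≤ massSq P) :
    energy (outgoing P ω) = P.1 / 2 + outgoingRadius P ω * inner ℝ P.2 ω / P.1 := by
  have hD : 0 < P.1 ^ 2 - inner ℝ P.2 ω ^ 2 := by linarith [massSq_le hω P]
  have hR := outgoingRadius_sq hω hs
  have hsl := massSq_le hω P
  set c := inner ℝ P.2 ω with hc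
  set R := outgoingRadius P ω
  apply energy_eq_of_sq
  -- After multiplication by E² - c² > 0 this follows from s - 4 ≤ E² - c² and c² ≤ E².
  · have h1 : (2 * (R * c)) ^ 2 ≤ (P.1 ^ 2) ^ 2 := by
      have h2 : (2 * (R * c)) ^ 2 * (P.1 ^ 2 - c ^ 2)
          ≤ (P.1 ^ 2) ^ 2 * (P.1 ^ 2 - c ^ 2) := by
        calc (2 * (R * c)) ^ 2 * (P.1 ^ 2 - c ^ 2)
            = (massSq P - 4) * (P.1 ^ 2 * c ^ 2) := by linear_combination c ^ 2 * hR
          _ ≤ (P.1 ^ 2 - c ^ 2) * (P.1 ^ 2 * P.1 ^ 2) := by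
              apply mul_le_mul (by linarith) _ (by positivity) hD.le
              exact mul_le_mul_of_nonneg_left (by linarith) (by positivity)
          _ = _ := by ring
      exact le_of_mul_le_mul_right h2 hD
    have h3 := (abs_le_of_sq_le_sq' h1 (by positivity)).1
    have : P.1 / 2 + R * c / P.1 = (P.1 ^ 2 + 2 * (R * c)) / (2 * P.1) := by field_simp
    rw [this]
    apply div_nonneg <;> linarith
  · unfold outgoing
    rw [norm_half_add_smul_sq hω]
    unfold massSq at hR
    change 1 + (‖P.2‖ ^ 2 / 4 + R * c + R ^ 2) = _
    field_simp
    linear_combination 4 * hR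

lemma outgoing_add_outgoing_neg (P : FourVector) (ω : Momentum) :
    outgoing P ω + outgoing P (-ω) = P.2 := by
  unfold outgoing
  rw [outgoingRadius_neg]
  module

lemma fourMomentum_outgoing_add {P : FourVector} {ω : Momentum} (hω : ‖ω‖ = 1) (hP : 0 < P.1)
    (hs : 4 ≤ massSq P) :
    fourMomentum (outgoing P ω) + fourMomentum (outgoing P (-ω)) = P := by
  refine Prod.ext ?_ (outgoing_add_outgoing_neg P ω)
  simp only [fourMomentum, Prod.fst_add]
  rw [energy_outgoing hω hP hs, energy_outgoing (by simpa using hω) hP hs, outgoingRadius_neg]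
  simp
  ring

lemma norm_lt_energy_add (k x : Momentum) :
    ‖k‖ < energy ((1 / 2 : ℝ) • k + x) + energy ((1 / 2 : ℝ) • k - x) := by
  calc ‖k‖ = ‖((1 / 2 : ℝ) • k + x) + ((1 / 2 : ℝ) • k - x)‖ := by congr 1; module
    _ ≤ _ := norm_add_le _ _
    _ < _ := add_lt_add (norm_lt_energy _) (norm_lt_energy _)

/-! ### Trading the radius for the total energy -/

/-- The total energy of two particles with momenta `k / 2 ± r ω`. -/
def pairEnergy (k ω : Momentum) (r : ℝ) : ℝ :=
  energy ((1 / 2 : ℝ) • k + r • ω) + energy ((1 / 2 : ℝ) • k - r • ω)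

section pairEnergy

variable {k ω : Momentum} (hω : ‖ω‖ = 1)
include hω

lemma energy_half_add_sq (r : ℝ) :
    energy ((1 / 2 : ℝ) • k + r • ω) ^ 2 = 1 + ‖k‖ ^ 2 / 4 + r * inner ℝ k ω + r ^ 2 := by
  rw [energy_sq, norm_half_add_smul_sq hω]; ring

lemma energy_half_sub_sq (r : ℝ) :
    energy ((1 / 2 : ℝ) • k - r • ω) ^ 2 = 1 + ‖k‖ ^ 2 / 4 - r * inner ℝ k ω + r ^ 2 := by
  have := energy_half_add_sq (k := k) hω (-r)
  rw [neg_smul, ← sub_eq_add_neg] at this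
  rw [this]; ring

lemma pairEnergy_sq_sub_pos (r : ℝ) : 0 < pairEnergy k ω r ^ 2 - inner ℝ k ω ^ 2 := by
  have h1 : ‖k‖ < pairEnergy k ω r := norm_lt_energy_add k (r • ω)
  have h2 := inner_sq_le hω k
  nlinarith [norm_nonneg k]

/-- With A, B the two energies, A² - B² = 2r⟨k, ω⟩ and 2(A² + B²) = 4 + |k|² + 4r². Eliminating A -
B leaves a relation for A + B alone. -/
lemma massSq_pairEnergy (r : ℝ) :
    (massSq (pairEnergy k ω r, k) - 4) * pairEnergy k ω r ^ 2
      = 4 * r ^ 2 * (pairEnergy k ω r ^ 2 - inner ℝ k ω ^ 2) := by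
  have hA := energy_half_add_sq (k := k) hω r
  have hB := energy_half_sub_sq (k := k) hω r
  simp only [massSq, pairEnergy]
  set A := energy ((1 / 2 : ℝ) • k + r • ω)
  set B := energy ((1 / 2 : ℝ) • k - r • ω)
  have h3 : (A - B) * (A + B) = 2 * (r * inner ℝ k ω) := by linear_combination hA - hB
  have h4 : (A + B) ^ 2 + (A - B) ^ 2 = 4 + ‖k‖ ^ 2 + 4 * r ^ 2 := by
    linear_combination 2 * hA + 2 * hB
  linear_combination (A + B) ^ 2 * h4 - ((A - B) * (A + B) + 2 * (r * inner ℝ k ω)) * h3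

lemma sqrt_massSq_pairEnergy {r : ℝ} (hr : 0 ≤ r) :
    √(massSq (pairEnergy k ω r, k) - 4) * pairEnergy k ω r
      = 2 * r * √(pairEnergy k ω r ^ 2 - inner ℝ k ω ^ 2) := by
  have hE : 0 < pairEnergy k ω r := add_pos (energy_pos _) (energy_pos _)
  have h := congrArg Real.sqrt (massSq_pairEnergy (k := k) hω r)
  rw [Real.sqrt_mul' _ (by positivity), Real.sqrt_sq hE.le,
    show 4 * r ^ 2 = (2 * r) ^ 2 by ring, Real.sqrt_mul (by positivity),
    Real.sqrt_sq (by positivity)] at h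
  exact h

lemma outgoingRadius_pairEnergy {r : ℝ} (hr : 0 ≤ r) :
    outgoingRadius (pairEnergy k ω r, k) ω = r := by
  have hD := Real.sqrt_pos.2 (pairEnergy_sq_sub_pos (k := k) hω r)
  have h := sqrt_massSq_pairEnergy (k := k) hω hr
  unfold outgoingRadius
  rw [div_eq_iff hD.ne']
  linarith

lemma hasDerivAt_energy_half_add (r : ℝ) :
    HasDerivAt (fun r => energy ((1 / 2 : ℝ) • k + r • ω))
      ((inner ℝ k ω + 2 * r) / (2 * energy ((1 / 2 : ℝ) • k + r • ω))) r := by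
  have h1 : (fun r : ℝ => energy ((1 / 2 : ℝ) • k + r • ω))
      = fun r => √(1 + ‖k‖ ^ 2 / 4 + r * inner ℝ k ω + r ^ 2) := by
    funext r
    rw [← energy_half_add_sq hω, Real.sqrt_sq (energy_pos _).le]
  have h2 : HasDerivAt (fun r : ℝ => 1 + ‖k‖ ^ 2 / 4 + r * inner ℝ k ω + r ^ 2)
      (inner ℝ k ω + 2 * r) r := by
    have := (((hasDerivAt_id r).mul_const (inner ℝ k ω)).const_add (1 + ‖k‖ ^ 2 / 4)).add
      (hasDerivAt_pow 2 r)
    exact this.congr_deriv (by simp)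
  have h3 := energy_half_add_sq (k := k) hω r
  have h4 := h2.sqrt (by rw [← h3]; exact (pow_pos (energy_pos _) 2).ne')
  rw [← h3, Real.sqrt_sq (energy_pos _).le] at h4
  rw [h1]
  exact h4

/-- The two derivatives add up to an expression containing A - B, which A² - B² = 2r⟨k, ω⟩ removes.
In this form the derivative is visibly positive for r > 0. -/
lemma hasDerivAt_pairEnergy (r : ℝ) :
    HasDerivAt (pairEnergy k ω)
      (r * (pairEnergy k ω r ^ 2 - inner ℝ k ω ^ 2) / (pairEnergy k ω r *
        (energy ((1 / 2 : ℝ) • k + r • ω) * energy ((1 / 2 : ℝ) • k - r • ω)))) r := by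
  have h1 := hasDerivAt_energy_half_add (k := k) hω r
  have h2 := hasDerivAt_energy_half_add (k := k) (ω := -ω) (by simpa using hω) r
  simp only [smul_neg, ← sub_eq_add_neg, inner_neg_right] at h2
  refine (h1.add h2).congr_deriv ?_
  have hA := energy_half_add_sq (k := k) hω r
  have hB := energy_half_sub_sq (k := k) hω r
  have hA0 := energy_pos ((1 / 2 : ℝ) • k + r • ω)
  have hB0 := energy_pos ((1 / 2 : ℝ) • k - r • ω)
  simp only [pairEnergy]
  set A := energy ((1 / 2 : ℝ) • k + r • ω)
  set B := energy ((1 / 2 : ℝ) • k - r • ω)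
  have h3 : A ^ 2 - B ^ 2 = 2 * (r * inner ℝ k ω) := by linear_combination hA - hB
  field_simp
  linear_combination (-(inner ℝ k ω)) * h3

lemma pairEnergy_outgoingRadius {E : ℝ} (hE : 0 < E) (hs : 4 ≤ massSq (E, k)) :
    pairEnergy k ω (outgoingRadius (E, k) ω) = E := by
  have := congrArg Prod.fst (fourMomentum_outgoing_add (P := (E, k)) hω hE hs)
  simp only [fourMomentum, outgoing, outgoingRadius_neg, Prod.fst_add, smul_neg,
    ← sub_eq_add_neg] at this
  exact this

/-- The substitution covers exactly the physical region, with inverse `outgoingRadius`. As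
`phaseDensity` vanishes elsewhere, the energy integral may then be extended to the whole line. -/
lemma pairEnergy_image :
    pairEnergy k ω '' Set.Ioi 0 = {E | 0 < E ∧ 4 < massSq (E, k)} := by
  ext E
  constructor
  · rintro ⟨r, hr, rfl⟩
    have hE : 0 < pairEnergy k ω r := add_pos (energy_pos _) (energy_pos _)
    refine ⟨hE, ?_⟩
    have h := massSq_pairEnergy (k := k) hω r
    have h2 : 0 < (massSq (pairEnergy k ω r, k) - 4) * pairEnergy k ω r ^ 2 := by
      rw [h]
      have := pairEnergy_sq_sub_pos (k := k) hω r
      have hr : 0 < r := hr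
      positivity
    have := pos_of_mul_pos_left h2 (by positivity)
    linarith
  · rintro ⟨hE, hs⟩
    refine ⟨outgoingRadius (E, k) ω, ?_, pairEnergy_outgoingRadius hω hE hs.le⟩
    have := massSq_le hω (E, k)
    have h1 : 0 < massSq (E, k) - 4 := by linarith
    have h2 : 0 < E ^ 2 - inner ℝ k ω ^ 2 := by simp at this; linarith
    simp only [outgoingRadius, Set.mem_Ioi]
    positivity

/-- This is where the formula for `phaseDensity` comes from: the polar factor r² and the mass-shell
densities 1/A and 1/B, divided by dE/dr. -/
lemma deriv_mul_phaseDensity {r : ℝ} (hr : 0 < r) :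
    (r * (pairEnergy k ω r ^ 2 - inner ℝ k ω ^ 2) / (pairEnergy k ω r *
        (energy ((1 / 2 : ℝ) • k + r • ω) * energy ((1 / 2 : ℝ) • k - r • ω)))) *
      phaseDensity (pairEnergy k ω r, k) ω =
    r ^ 2 * (1 / energy ((1 / 2 : ℝ) • k + r • ω) * (1 / energy ((1 / 2 : ℝ) • k - r • ω))) := by
  have hE : 0 < pairEnergy k ω r := add_pos (energy_pos _) (energy_pos _)
  have hA0 := energy_pos ((1 / 2 : ℝ) • k + r • ω)
  have hB0 := energy_pos ((1 / 2 : ℝ) • k - r • ω)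
  have hD2 := pairEnergy_sq_sub_pos (k := k) hω r
  have hD := Real.sqrt_pos.2 hD2
  have h := sqrt_massSq_pairEnergy (k := k) hω hr.le
  have hsq := Real.sq_sqrt hD2.le
  simp only [phaseDensity, if_pos hE]
  set D := √(pairEnergy k ω r ^ 2 - inner ℝ k ω ^ 2)
  rw [← hsq]
  field_simp
  linear_combination h

/-- Substitution of the radius by the total energy. -/
lemma lintegral_radius_eq (h : ℝ → ℝ≥0∞) :
    ∫⁻ r in Set.Ioi (0 : ℝ), ENNReal.ofReal (r ^ 2) *
        (ENNReal.ofReal (1 / energy ((1 / 2 : ℝ) • k + r • ω)) *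
          ENNReal.ofReal (1 / energy ((1 / 2 : ℝ) • k - r • ω)) * h r) =
      ∫⁻ E, ENNReal.ofReal (phaseDensity (E, k) ω) * h (outgoingRadius (E, k) ω) := by
  have hinj : Set.InjOn (pairEnergy k ω) (Set.Ioi 0) := by
    intro r hr r' hr' he
    have := outgoingRadius_pairEnergy (k := k) hω (le_of_lt hr)
    rw [he, outgoingRadius_pairEnergy (k := k) hω (le_of_lt hr')] at this
    exact this.symm
  have hsupp : ∫⁻ E, ENNReal.ofReal (phaseDensity (E, k) ω) * h (outgoingRadius (E, k) ω) =
      ∫⁻ E in pairEnergy k ω '' Set.Ioi 0,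
        ENNReal.ofReal (phaseDensity (E, k) ω) * h (outgoingRadius (E, k) ω) := by
    symm
    apply setLIntegral_eq_of_support_subset
    intro E hE
    rw [pairEnergy_image hω]
    refine pos_of_phaseDensity_ne_zero (P := (E, k)) (ω := ω) (fun h0 => ?_)
    simp [h0] at hE
  rw [hsupp, lintegral_image_eq_lintegral_abs_deriv_mul measurableSet_Ioi
    (fun r _ => (hasDerivAt_pairEnergy hω r).hasDerivWithinAt) hinj]
  refine setLIntegral_congr_fun measurableSet_Ioi (fun r hr => ?_)
  have hr : 0 < r := hr
  have hE : 0 < pairEnergy k ω r := add_pos (energy_pos _) (energy_pos _)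
  have hA0 := energy_pos ((1 / 2 : ℝ) • k + r • ω)
  have hB0 := energy_pos ((1 / 2 : ℝ) • k - r • ω)
  have hD2 := pairEnergy_sq_sub_pos (k := k) hω r
  rw [outgoingRadius_pairEnergy hω hr.le, abs_of_nonneg (by positivity),
    ← ENNReal.ofReal_mul (by positivity), ← mul_assoc, ← ENNReal.ofReal_mul (by positivity),
    ← deriv_mul_phaseDensity hω hr, ENNReal.ofReal_mul (by positivity), mul_assoc]

end pairEnergy

/-! ### Disintegration of two-particle phase space -/

/-- The unit sphere of directions. -/
abbrev Direction : Type := Metric.sphere (0 : Momentum) 1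

/-- The surface measure on the unit sphere of directions. -/
abbrev directionMeasure : Measure Direction := (volume : Measure Momentum).toSphere

/-- Integration in polar coordinates. -/
lemma lintegral_polar {G : Momentum → ℝ≥0∞} (hG : Measurable G) :
    ∫⁻ x, G x = ∫⁻ ω : Direction, ∫⁻ r in Set.Ioi (0 : ℝ),
      ENNReal.ofReal (r ^ 2) * G (r • (ω : Momentum)) ∂volume ∂directionMeasure := by
  have hmp := (volume : Measure Momentum).measurePreserving_homeomorphUnitSphereProd
  have hdim : Module.finrank ℝ Momentum - 1 = 2 := by simp
  rw [hdim] at hmp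
  have h0 : ∫⁻ x, G x = ∫⁻ x : ({(0 : Momentum)}ᶜ : Set Momentum), G x
      ∂((volume : Measure Momentum).comap (↑)) := by
    rw [lintegral_subtype_comap (measurableSet_singleton _).compl, restrict_compl_singleton]
  have h1 := hmp.lintegral_comp_emb (Homeomorph.measurableEmbedding _)
    (fun z => G ((z.2 : ℝ) • (z.1 : Momentum)))
  have h2 : ∀ x : ({(0 : Momentum)}ᶜ : Set Momentum),
      G (((homeomorphUnitSphereProd Momentum x).2 : ℝ) •
        ((homeomorphUnitSphereProd Momentum x).1 : Momentum)) = G x := by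
    intro x
    have hx : ‖(x : Momentum)‖ ≠ 0 := norm_ne_zero_iff.2 x.2
    congr 1
    simp [smul_smul, hx]
  simp only [h2] at h1
  rw [h0, h1, lintegral_prod _ (by fun_prop)]
  refine lintegral_congr fun ω => ?_
  rw [Measure.volumeIoiPow, lintegral_withDensity_eq_lintegral_mul _ (by fun_prop) (by fun_prop)]
  exact lintegral_subtype_comap measurableSet_Ioi
    (fun r : ℝ => ENNReal.ofReal (r ^ 2) * G (r • (ω : Momentum)))

@[fun_prop]
lemma measurable_massSq : Measurable massSq := by
  unfold massSq; fun_prop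

@[fun_prop]
lemma measurable_outgoingRadius :
    Measurable (fun z : FourVector × Momentum => outgoingRadius z.1 z.2) := by
  unfold outgoingRadius; fun_prop

@[fun_prop]
lemma measurable_phaseDensity :
    Measurable (fun z : FourVector × Momentum => phaseDensity z.1 z.2) := by
  unfold phaseDensity
  exact Measurable.ite (measurableSet_lt measurable_const (by fun_prop)) (by fun_prop)
    measurable_const

@[fun_prop]
lemma measurable_outgoing :
    Measurable (fun z : FourVector × Momentum => outgoing z.1 z.2) := by
  unfold outgoing; fun_prop

/-- Measurability of `outgoing` along measurable maps. -/
@[fun_prop]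
lemma Measurable.outgoing {X : Type*} [MeasurableSpace X] {u : X → FourVector} {v : X → Momentum}
    (hu : Measurable u) (hv : Measurable v) :
    Measurable (fun x => RelBoltzmann.outgoing (u x) (v x)) :=
  measurable_outgoing.comp (hu.prodMk hv)

/-- Measurability of `phaseDensity` along measurable maps. -/
@[fun_prop]
lemma Measurable.phaseDensity {X : Type*} [MeasurableSpace X] {u : X → FourVector}
    {v : X → Momentum} (hu : Measurable u) (hv : Measurable v) :
    Measurable (fun x => RelBoltzmann.phaseDensity (u x) (v x)) :=
  measurable_phaseDensity.comp (hu.prodMk hv)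

lemma lintegral_shellMeasure {G : Momentum → ℝ≥0∞} (hG : Measurable G) :
    ∫⁻ p, G p ∂shellMeasure = ∫⁻ p, ENNReal.ofReal (1 / energy p) * G p := by
  unfold shellMeasure
  rw [lintegral_withDensity_eq_lintegral_mul _ _ hG]
  · rfl
  · have := continuous_energy.measurable
    fun_prop

/-- Two-particle phase space in terms of the total four-momentum and the direction. -/
lemma lintegral_shellMeasure_prod {h : Momentum × Momentum → ℝ≥0∞} (hh : Measurable h) :
    ∫⁻ x, h x ∂(shellMeasure.prod shellMeasure) =
      ∫⁻ P : FourVector, ∫⁻ ω : Direction, ENNReal.ofReal (phaseDensity P ω) *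
        h (outgoing P ω, outgoing P (-(ω : Momentum))) ∂directionMeasure := by
  have hen := continuous_energy.measurable
  set w : Momentum → ℝ≥0∞ := fun p => ENNReal.ofReal (1 / energy p) with hw
  have hwm : Measurable w := by fun_prop
  calc ∫⁻ x, h x ∂(shellMeasure.prod shellMeasure)
      = ∫⁻ p, ∫⁻ q, w p * w q * h (p, q) := by
        rw [lintegral_prod _ hh.aemeasurable, lintegral_shellMeasure (by fun_prop)]
        refine lintegral_congr fun p => ?_
        rw [lintegral_shellMeasure (by fun_prop), ← lintegral_const_mul _ (by fun_prop)]
        simp only [mul_assoc, hw]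
    -- The total momentum k replaces q, and p is then recentred at k/2, so that the pair is k/2 ± x.
    -- Polar coordinates in x and `lintegral_radius_eq` finish.
    _ = ∫⁻ p, ∫⁻ k, w p * w (k - p) * h (p, k - p) := by
        refine lintegral_congr fun p => ?_
        exact (lintegral_sub_right_eq_self (fun q => w p * w q * h (p, q)) p).symm
    _ = ∫⁻ k, ∫⁻ p, w p * w (k - p) * h (p, k - p) :=
        lintegral_lintegral_swap (by fun_prop)
    _ = ∫⁻ k, ∫⁻ x, w ((1 / 2 : ℝ) • k + x) * w ((1 / 2 : ℝ) • k - x) *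
          h ((1 / 2 : ℝ) • k + x, (1 / 2 : ℝ) • k - x) := by
        refine lintegral_congr fun k => ?_
        rw [← lintegral_add_left_eq_self _ ((1 / 2 : ℝ) • k)]
        refine lintegral_congr fun x => ?_
        have : k - ((1 / 2 : ℝ) • k + x) = (1 / 2 : ℝ) • k - x := by module
        rw [this]
    _ = ∫⁻ k, ∫⁻ ω : Direction, ∫⁻ E, ENNReal.ofReal (phaseDensity (E, k) ω) *
          h (outgoing (E, k) ω, outgoing (E, k) (-(ω : Momentum)))
            ∂volume ∂directionMeasure := by
        refine lintegral_congr fun k => ?_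
        rw [lintegral_polar (by fun_prop)]
        refine lintegral_congr fun ω => ?_
        have hω : ‖(ω : Momentum)‖ = 1 := by simp
        have := lintegral_radius_eq (k := k) hω (fun r =>
          h ((1 / 2 : ℝ) • k + r • (ω : Momentum), (1 / 2 : ℝ) • k - r • (ω : Momentum)))
        simp only [hw, this, outgoing, outgoingRadius_neg, smul_neg, ← sub_eq_add_neg]
    _ = ∫⁻ k, ∫⁻ E, ∫⁻ ω : Direction, ENNReal.ofReal (phaseDensity (E, k) ω) *
          h (outgoing (E, k) ω, outgoing (E, k) (-(ω : Momentum)))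
            ∂directionMeasure ∂volume := by
        refine lintegral_congr fun k => ?_
        exact lintegral_lintegral_swap (by fun_prop)
    _ = _ := by
        rw [Measure.volume_eq_prod, lintegral_prod_symm _ (by fun_prop)]

lemma norm_direction (ω : Direction) : ‖(ω : Momentum)‖ = 1 := by simp

/-- Cauchy–Schwarz for the plane vectors (1, |p|) and (1, |q|). -/
lemma one_add_norm_mul_norm_le (p q : Momentum) : 1 + ‖p‖ * ‖q‖ ≤ energy p * energy q := by
  have hp := energy_sq p
  have hq := energy_sq q
  have h : (1 + ‖p‖ * ‖q‖) ^ 2 ≤ (energy p * energy q) ^ 2 := by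
    rw [mul_pow, hp, hq]; nlinarith [sq_nonneg (‖p‖ - ‖q‖)]
  exact (abs_le_of_sq_le_sq' h (mul_pos (energy_pos p) (energy_pos q)).le).2

lemma massSq_fourMomentum_add (p q : Momentum) :
    massSq (fourMomentum p + fourMomentum q) = 2 + 2 * (energy p * energy q - inner ℝ p q) := by
  have hp := energy_sq p
  have hq := energy_sq q
  have := norm_add_sq_real p q
  simp only [massSq, fourMomentum, Prod.fst_add, Prod.snd_add]
  linear_combination hp + hq - this

lemma four_le_massSq_fourMomentum_add (p q : Momentum) :
    4 ≤ massSq (fourMomentum p + fourMomentum q) := by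
  rw [massSq_fourMomentum_add]
  linarith [one_add_norm_mul_norm_le p q, real_inner_le_norm p q]

lemma fourMomentum_add_fst_pos (p q : Momentum) : 0 < (fourMomentum p + fourMomentum q).1 :=
  add_pos (energy_pos p) (energy_pos q)

@[fun_prop]
lemma continuous_fourMomentum : Continuous fourMomentum := by
  unfold fourMomentum; fun_prop

@[fun_prop]
lemma measurable_fourMomentum : Measurable fourMomentum := continuous_fourMomentum.measurable

/-- In the physical region E² - ⟨k, ω⟩² ≥ s > 4, so the denominator is at least 1, while √(s - 4) ≤
E. -/
lemma phaseDensity_le {ω : Momentum} (hω : ‖ω‖ = 1) (P : FourVector) :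
    phaseDensity P ω ≤ |P.1| ^ 3 := by
  by_cases h0 : phaseDensity P ω = 0
  · rw [h0]; positivity
  obtain ⟨hE, hs⟩ := pos_of_phaseDensity_ne_zero h0
  have hD : 1 ≤ √(P.1 ^ 2 - inner ℝ P.2 ω ^ 2) := by
    rw [Real.one_le_sqrt]; linarith [massSq_le hω P]
  have hs' : √(massSq P - 4) ≤ P.1 := by
    rw [Real.sqrt_le_left hE.le]; unfold massSq; nlinarith [sq_nonneg ‖P.2‖]
  have hD3 : 1 ≤ √(P.1 ^ 2 - inner ℝ P.2 ω ^ 2) ^ 3 := one_le_pow₀ hD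
  rw [phaseDensity, if_pos hE, abs_of_pos hE, div_le_iff₀ (by linarith)]
  calc √(massSq P - 4) / 2 * P.1 ^ 2 ≤ P.1 * P.1 ^ 2 := by
        gcongr; linarith [Real.sqrt_nonneg (massSq P - 4)]
    _ = P.1 ^ 3 * 1 := by ring
    _ ≤ _ := by gcongr

/-- The threshold s = 4 must be included because q = p attains it; the square root is continuous
there and the denominator stays away from 0. -/
lemma continuousAt_outgoing {ω : Momentum} (hω : ‖ω‖ = 1) {P : FourVector}
    (hs : 4 ≤ massSq P) : ContinuousAt (fun P => outgoing P ω) P := by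
  have hD : √(P.1 ^ 2 - inner ℝ P.2 ω ^ 2) ≠ 0 := by
    rw [Real.sqrt_ne_zero']; linarith [massSq_le hω P]
  unfold outgoing outgoingRadius massSq
  fun_prop (disch := assumption)

lemma continuousAt_phaseDensity {ω : Momentum} (hω : ‖ω‖ = 1) {P : FourVector} (hE : 0 < P.1)
    (hs : 4 ≤ massSq P) : ContinuousAt (fun P => phaseDensity P ω) P := by
  have hD : √(P.1 ^ 2 - inner ℝ P.2 ω ^ 2) ^ 3 ≠ 0 := by
    apply pow_ne_zero
    rw [Real.sqrt_ne_zero']; linarith [massSq_le hω P]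
  have h1 : ContinuousAt (fun P : FourVector =>
      √(massSq P - 4) / 2 * P.1 ^ 2 / √(P.1 ^ 2 - inner ℝ P.2 ω ^ 2) ^ 3) P := by
    unfold massSq
    fun_prop (disch := assumption)
  refine h1.congr ?_
  filter_upwards [continuous_fst.continuousAt.eventually (lt_mem_nhds hE)] with Q hQ
  rw [phaseDensity, if_pos hQ]

/-! ### Construction of the collision measure -/

/-- The triple `(q, q', p')` with `p^μ + q^μ - p'^μ - q'^μ = v` and `q'` in the direction `ω`. -/
def collisionTriple (p : Momentum) (v : FourVector) (z : Momentum × Direction) :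
    Momentum × Momentum × Momentum :=
  (z.1, outgoing (fourMomentum p + fourMomentum z.1 - v) z.2,
    outgoing (fourMomentum p + fourMomentum z.1 - v) (-(z.2 : Momentum)))

/-- The density belonging to `collisionTriple`. -/
def collisionDensity (p : Momentum) (v : FourVector) (z : Momentum × Direction) : ℝ :=
  phaseDensity (fourMomentum p + fourMomentum z.1 - v) z.2

lemma collisionDensity_nonneg (p : Momentum) (v : FourVector) (z : Momentum × Direction) :
    0 ≤ collisionDensity p v z := phaseDensity_nonneg _ _

lemma measurable_collisionTriple (p : Momentum) :
    Measurable (fun y : FourVector × Momentum × Direction => collisionTriple p y.1 y.2) := by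
  unfold collisionTriple; fun_prop

lemma measurable_collisionDensity (p : Momentum) :
    Measurable (fun y : FourVector × Momentum × Direction => collisionDensity p y.1 y.2) := by
  unfold collisionDensity; fun_prop

lemma conservationDefect_collisionTriple {p : Momentum} {v : FourVector}
    {z : Momentum × Direction} (h : collisionDensity p v z ≠ 0) :
    conservationDefect p (collisionTriple p v z) = v := by
  obtain ⟨hE, hs⟩ := pos_of_phaseDensity_ne_zero h
  have := fourMomentum_outgoing_add (norm_direction z.2) hE hs.le
  simp only [conservationDefect, collisionTriple]
  rw [sub_sub, add_comm (fourMomentum (outgoing _ (-_))), this]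
  abel

instance : (volume : Measure FourVector).IsAddHaarMeasure :=
  inferInstanceAs ((volume : Measure ℝ).prod (volume : Measure Momentum)).IsAddHaarMeasure

/-- `tripleMeasure` disintegrated with respect to the conservation defect. -/
lemma tripleMeasure_eq_map (p : Momentum) :
    tripleMeasure = Measure.map (fun y => collisionTriple p y.1 y.2)
      (((volume : Measure FourVector).prod (shellMeasure.prod directionMeasure)).withDensity
        (fun y => ENNReal.ofReal (collisionDensity p y.1 y.2))) := by
  have hcm := measurable_collisionTriple p
  have hdm := measurable_collisionDensity p
  refine Measure.ext fun s hs => ?_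
  set G : Momentum × Momentum × Momentum → ℝ≥0∞ := s.indicator 1 with hG
  have hGm : Measurable G := measurable_one.indicator hs
  rw [← lintegral_indicator_one hs, ← lintegral_indicator_one hs, ← hG,
    lintegral_map hGm hcm, lintegral_withDensity_eq_lintegral_mul _ (by fun_prop) (by fun_prop),
    lintegral_prod _ (by fun_prop)]
  simp only [Pi.mul_apply]
  calc ∫⁻ x, G x ∂tripleMeasure
      = ∫⁻ q, ∫⁻ P : FourVector, ∫⁻ ω : Direction, ENNReal.ofReal (phaseDensity P ω) *
          G (q, outgoing P ω, outgoing P (-(ω : Momentum))) ∂directionMeasure ∂volume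
          ∂shellMeasure := by
        rw [tripleMeasure, lintegral_prod _ hGm.aemeasurable]
        refine lintegral_congr fun q => ?_
        exact lintegral_shellMeasure_prod (h := fun y => G (q, y)) (by fun_prop)
    _ = ∫⁻ q, ∫⁻ v : FourVector, ∫⁻ ω : Direction, ENNReal.ofReal (collisionDensity p v (q, ω)) *
          G (collisionTriple p v (q, ω)) ∂directionMeasure ∂volume ∂shellMeasure := by
        refine lintegral_congr fun q => ?_
        -- For fixed q, the reflected translation P = p^μ + q^μ - v preserves Lebesgue measure and
        -- makes the defect v the variable.
        exact (lintegral_sub_left_eq_self (fun P : FourVector => ∫⁻ ω : Direction,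
          ENNReal.ofReal (phaseDensity P ω) *
          G (q, outgoing P ω, outgoing P (-(ω : Momentum))) ∂directionMeasure)
          (fourMomentum p + fourMomentum q)).symm
    _ = ∫⁻ v : FourVector, ∫⁻ q, ∫⁻ ω : Direction, ENNReal.ofReal (collisionDensity p v (q, ω)) *
          G (collisionTriple p v (q, ω)) ∂directionMeasure ∂shellMeasure ∂volume := by
        refine lintegral_lintegral_swap ?_
        unfold collisionDensity collisionTriple
        fun_prop
    _ = _ := by
        refine lintegral_congr fun v => ?_
        rw [lintegral_prod _ (by unfold collisionDensity collisionTriple; fun_prop)]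

/-- The measure `δ⁽⁴⁾(p^μ + q^μ - p'^μ - q'^μ) (dq / q⁰) (dq' / q'⁰) (dp' / p'⁰)`, as an integral
over `q` and the direction of `q'` in a frame symmetric about the mean momentum. -/
def explicitCollisionMeasure (p : Momentum) : Measure (Momentum × Momentum × Momentum) :=
  Measure.map (collisionTriple p 0) ((shellMeasure.prod directionMeasure).withDensity
    (fun z => ENNReal.ofReal (collisionDensity p 0 z)))

lemma shellMeasure_le (s : Set Momentum) (hs : MeasurableSet s) : shellMeasure s ≤ volume s := by
  rw [shellMeasure, withDensity_apply _ hs]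
  calc _ ≤ ∫⁻ _ in s, 1 := by
        refine lintegral_mono fun p => ?_
        rw [ENNReal.ofReal_le_one, div_le_one (energy_pos p)]
        exact one_le_energy p
    _ = _ := by simp

instance : IsFiniteMeasureOnCompacts shellMeasure where
  lt_top_of_isCompact K hK := (shellMeasure_le K hK.measurableSet).trans_lt hK.measure_lt_top

/-- Uniformity in v near 0 serves both local finiteness and dominated convergence. Only q needs
confining, since the directions form a compact sphere. -/
lemma exists_collisionDensity_le (p : Momentum) {K : Set Momentum} (hK : IsCompact K) :
    ∃ C : ℝ, 0 ≤ C ∧ ∀ v : FourVector, ‖v‖ < 1 → ∀ z : Momentum × Direction, z.1 ∈ K →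
      collisionDensity p v z ≤ C := by
  obtain ⟨M, hM⟩ := hK.exists_bound_of_continuousOn continuous_energy.continuousOn
  refine ⟨(energy p + |M| + 1) ^ 3, by have := energy_pos p; positivity, fun v hv z hz => ?_⟩
  refine (phaseDensity_le (norm_direction z.2) _).trans ?_
  gcongr
  have h1 : |v.1| ≤ ‖v‖ := norm_fst_le v
  have h2 : energy z.1 ≤ |M| := ((le_abs_self _).trans (hM z.1 hz)).trans (le_abs_self M)
  simp only [Prod.fst_sub, Prod.fst_add, fourMomentum]
  calc |energy p + energy z.1 - v.1| ≤ |energy p + energy z.1| + |v.1| := abs_sub _ _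
    _ ≤ _ := by
      rw [abs_of_pos (add_pos (energy_pos _) (energy_pos _))]
      linarith

instance (p : Momentum) : IsFiniteMeasureOnCompacts (explicitCollisionMeasure p) where
  lt_top_of_isCompact K hK := by
    obtain ⟨C, hC, hb⟩ := exists_collisionDensity_le p (hK.image continuous_fst)
    have hcm : Measurable (collisionTriple p 0) :=
      (measurable_collisionTriple p).comp measurable_prodMk_left
    have hT : MeasurableSet ((Prod.fst '' K) ×ˢ Set.univ : Set (Momentum × Direction)) :=
      (hK.image continuous_fst).measurableSet.prod .univ
    rw [explicitCollisionMeasure, Measure.map_apply hcm hK.measurableSet]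
    calc _ ≤ (shellMeasure.prod directionMeasure).withDensity
            (fun z => ENNReal.ofReal (collisionDensity p 0 z)) ((Prod.fst '' K) ×ˢ Set.univ) := by
          apply measure_mono
          intro z hz
          exact ⟨⟨_, hz, rfl⟩, trivial⟩
      _ ≤ ∫⁻ _ in (Prod.fst '' K) ×ˢ Set.univ, ENNReal.ofReal C
            ∂(shellMeasure.prod directionMeasure) := by
          rw [withDensity_apply _ hT]
          refine setLIntegral_mono measurable_const fun z hz => ?_
          exact ENNReal.ofReal_le_ofReal (hb 0 (by simp) z hz.1)
      _ < ⊤ := by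
          rw [setLIntegral_const, Measure.prod_prod]
          exact ENNReal.mul_lt_top ENNReal.ofReal_lt_top (ENNReal.mul_lt_top
            (hK.image continuous_fst).measure_lt_top (measure_lt_top _ _))

/-! ### The limit of the ball averages -/

/-- The averages over small balls converge to the value at a point of continuity. -/
lemma tendsto_ball_average {V : Type*} [NormedAddCommGroup V] [MeasurableSpace V]
    [OpensMeasurableSpace V] (μ : Measure V) [μ.IsOpenPosMeasure]
    {F : V → ℝ} (hF : ContinuousAt F 0) {r : ℝ} (hr : 0 < r) (hμ : μ (Metric.ball 0 r) < ⊤)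
    (hFi : IntegrableOn F (Metric.ball 0 r) μ) :
    Tendsto (fun ε : ℝ => (μ.real (Metric.ball 0 ε))⁻¹ * ∫ v in Metric.ball 0 ε, F v ∂μ)
      (𝓝[>] 0) (𝓝 (F 0)) := by
  rw [Metric.tendsto_nhds]
  intro δ hδ
  obtain ⟨η, hη, hFη⟩ := Metric.continuousAt_iff.1 hF (δ / 2) (half_pos hδ)
  filter_upwards [Ioo_mem_nhdsGT (lt_min hη hr)] with ε hε
  have hε0 : 0 < ε := hε.1
  have hεη : ε < η := hε.2.trans_le (min_le_left _ _)
  have hεr : ε < r := hε.2.trans_le (min_le_right _ _)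
  have hsub : Metric.ball (0 : V) ε ⊆ Metric.ball 0 r := Metric.ball_subset_ball hεr.le
  have hfin : μ (Metric.ball (0 : V) ε) < ⊤ := (measure_mono hsub).trans_lt hμ
  have hpos : 0 < μ.real (Metric.ball (0 : V) ε) :=
    ENNReal.toReal_pos (Metric.measure_ball_pos μ 0 hε0).ne' hfin.ne
  have h1 : ∫ v in Metric.ball 0 ε, (F v - F 0) ∂μ
      = (∫ v in Metric.ball 0 ε, F v ∂μ) - μ.real (Metric.ball 0 ε) * F 0 := by
    rw [integral_sub (hFi.mono_set hsub) (integrableOn_const hfin.ne), setIntegral_const]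
    rfl
  have h2 : ‖∫ v in Metric.ball 0 ε, (F v - F 0) ∂μ‖ ≤ δ / 2 * μ.real (Metric.ball 0 ε) := by
    refine norm_setIntegral_le_of_norm_le_const hfin fun v hv => ?_
    rw [← dist_eq_norm]
    exact (hFη ((Metric.mem_ball.1 hv).trans hεη)).le
  have h3 : (μ.real (Metric.ball 0 ε))⁻¹ * (∫ v in Metric.ball 0 ε, F v ∂μ) - F 0
      = (μ.real (Metric.ball 0 ε))⁻¹ * ∫ v in Metric.ball 0 ε, (F v - F 0) ∂μ := by
    rw [h1]; field_simp
  rw [Real.dist_eq, h3, ← Real.norm_eq_abs, norm_mul, norm_inv, Real.norm_of_nonneg hpos.le]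
  calc _ ≤ (μ.real (Metric.ball 0 ε))⁻¹ * (δ / 2 * μ.real (Metric.ball 0 ε)) := by gcongr
    _ = δ / 2 := by field_simp
    _ < δ := half_lt_self hδ

/-- The integrals of a test function over the level sets of the conservation defect. -/
def levelIntegral (p : Momentum) (φ : Momentum × Momentum × Momentum → ℝ) (v : FourVector) : ℝ :=
  ∫ z, collisionDensity p v z * φ (collisionTriple p v z) ∂(shellMeasure.prod directionMeasure)

section

variable {φ : Momentum × Momentum × Momentum → ℝ}

/-- The first entry of the triple is q itself, so the compact support of φ confines q to a compact
set independent of v. -/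
lemma exists_collisionIntegrand_bound (p : Momentum) (hφ : Continuous φ)
    (hc : HasCompactSupport φ) :
    ∃ (K : Set Momentum) (C : ℝ), IsCompact K ∧ ∀ v : FourVector, ‖v‖ < 1 →
      ∀ z : Momentum × Direction, ‖collisionDensity p v z * φ (collisionTriple p v z)‖ ≤
        (K ×ˢ Set.univ).indicator (fun _ => C) z := by
  have hK : IsCompact (Prod.fst '' tsupport φ) := hc.isCompact.image continuous_fst
  obtain ⟨C, hC, hb⟩ := exists_collisionDensity_le p hK
  obtain ⟨M, hM⟩ := hφ.bounded_above_of_compact_support hc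
  have hM0 : 0 ≤ M := (norm_nonneg _).trans (hM 0)
  refine ⟨_, C * M, hK, fun v hv z => ?_⟩
  by_cases hz : z.1 ∈ Prod.fst '' tsupport φ
  · rw [Set.indicator_of_mem (show z ∈ (Prod.fst '' tsupport φ) ×ˢ Set.univ from ⟨hz, trivial⟩),
      norm_mul, Real.norm_of_nonneg (collisionDensity_nonneg p v z)]
    exact mul_le_mul (hb v hv z hz) (hM _) (norm_nonneg _) hC
  · have h0 : φ (collisionTriple p v z) = 0 := by
      by_contra h
      exact hz ⟨_, subset_tsupport φ h, rfl⟩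
    rw [h0, mul_zero, norm_zero]
    exact Set.indicator_nonneg (fun _ _ => by positivity) _

lemma integrable_indicator_const_prod_univ {K : Set Momentum} (hK : IsCompact K) (C : ℝ) :
    Integrable ((K ×ˢ Set.univ).indicator (fun _ => C)) (shellMeasure.prod directionMeasure) := by
  rw [integrable_indicator_iff (hK.measurableSet.prod .univ)]
  refine integrableOn_const ?_
  rw [Measure.prod_prod]
  exact (ENNReal.mul_lt_top hK.measure_lt_top (measure_lt_top _ _)).ne

lemma measurable_collisionIntegrand (p : Momentum) (hφ : Continuous φ) :
    Measurable (fun y : FourVector × Momentum × Direction =>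
      collisionDensity p y.1 y.2 * φ (collisionTriple p y.1 y.2)) :=
  (measurable_collisionDensity p).mul (hφ.measurable.comp (measurable_collisionTriple p))

/-- Dominated convergence. Pointwise continuity at v = 0 holds for every (q, ω), as p^μ + q^μ has
positive energy and squared mass at least 4. -/
lemma continuousAt_levelIntegral (p : Momentum) (hφ : Continuous φ) (hc : HasCompactSupport φ) :
    ContinuousAt (levelIntegral p φ) 0 := by
  obtain ⟨K, C, hK, hb⟩ := exists_collisionIntegrand_bound p hφ hc
  have hm := measurable_collisionIntegrand p hφ
  refine continuousAt_of_dominated (bound := (K ×ˢ Set.univ).indicator (fun _ => C)) ?_ ?_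
    (integrable_indicator_const_prod_univ hK C) ?_
  · exact Eventually.of_forall fun v => (hm.comp measurable_prodMk_left).aestronglyMeasurable
  · filter_upwards [Metric.ball_mem_nhds (0 : FourVector) one_pos] with v hv
    exact Eventually.of_forall fun z => hb v (by simpa using hv) z
  · refine Eventually.of_forall fun z => ?_
    have hT : ContinuousAt (fun v : FourVector => fourMomentum p + fourMomentum z.1 - v) 0 := by
      fun_prop
    have hs : 4 ≤ massSq (fourMomentum p + fourMomentum z.1 - 0) := by
      rw [sub_zero]; exact four_le_massSq_fourMomentum_add _ _
    have hE : 0 < (fourMomentum p + fourMomentum z.1 - 0).1 := by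
      rw [sub_zero]; exact fourMomentum_add_fst_pos _ _
    have hω := norm_direction z.2
    have h1 := ContinuousAt.comp (f := fun v : FourVector => fourMomentum p + fourMomentum z.1 - v)
      (continuousAt_phaseDensity hω hE hs) hT
    have h2 := ContinuousAt.comp (f := fun v : FourVector => fourMomentum p + fourMomentum z.1 - v)
      (continuousAt_outgoing hω hs) hT
    have h3 := ContinuousAt.comp (f := fun v : FourVector => fourMomentum p + fourMomentum z.1 - v)
      (continuousAt_outgoing (ω := -(z.2 : Momentum)) (by simp) hs) hT
    exact h1.mul (hφ.continuousAt.comp (continuousAt_const.prodMk (h2.prodMk h3)))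

lemma integrableOn_collisionIntegrand (p : Momentum) (hφ : Continuous φ)
    (hc : HasCompactSupport φ) :
    IntegrableOn (fun y : FourVector × Momentum × Direction =>
      collisionDensity p y.1 y.2 * φ (collisionTriple p y.1 y.2))
      (Metric.ball 0 1 ×ˢ Set.univ)
      ((volume : Measure FourVector).prod (shellMeasure.prod directionMeasure)) := by
  obtain ⟨K, C, hK, hb⟩ := exists_collisionIntegrand_bound p hφ hc
  have hm := measurable_collisionIntegrand p hφ
  rw [IntegrableOn, ← Measure.prod_restrict, Measure.restrict_univ]
  have h1 : Integrable (fun _ : FourVector => (1 : ℝ))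
      (volume.restrict (Metric.ball (0 : FourVector) 1)) :=
    integrableOn_const measure_ball_lt_top.ne
  refine Integrable.mono' (h1.mul_prod (integrable_indicator_const_prod_univ hK C))
    hm.aestronglyMeasurable ?_
  have h2 : ∀ᵐ y ∂((volume.restrict (Metric.ball (0 : FourVector) 1)).prod
      (shellMeasure.prod directionMeasure)), y.1 ∈ Metric.ball (0 : FourVector) 1 :=
    Measure.quasiMeasurePreserving_fst.ae (ae_restrict_mem measurableSet_ball)
  filter_upwards [h2] with y hy
  rw [one_mul]
  exact hb y.1 (by simpa using hy) y.2

/-- Wherever the density is nonzero, the defect of `collisionTriple p v z` is v, so the condition on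
the defect becomes ‖v‖ < ε and Fubini applies. The restriction ε ≤ 1 keeps v in the range of the
uniform bound. -/
lemma setIntegral_conservationDefect_lt (p : Momentum) (hφ : Continuous φ)
    (hc : HasCompactSupport φ) {ε : ℝ} (hε : ε ≤ 1) :
    ∫ x in {x | ‖conservationDefect p x‖ < ε}, φ x ∂tripleMeasure
      = ∫ v in Metric.ball 0 ε, levelIntegral p φ v := by
  have hcm := measurable_collisionTriple p
  have hdm := measurable_collisionDensity p
  have hdef : Continuous (conservationDefect p) := by
    unfold conservationDefect; fun_prop
  have hS : MeasurableSet {x | ‖conservationDefect p x‖ < ε} :=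
    (isOpen_lt (by fun_prop) continuous_const).measurableSet
  have hB : MeasurableSet (Metric.ball (0 : FourVector) ε ×ˢ (Set.univ : Set (Momentum × Direction)))
    := measurableSet_ball.prod .univ
  have hint := (integrableOn_collisionIntegrand p hφ hc).mono_set
    (Set.prod_mono_left (Metric.ball_subset_ball (x := (0 : FourVector)) hε))
  rw [tripleMeasure_eq_map p, ← integral_indicator hS, integral_map hcm.aemeasurable
    (hφ.measurable.indicator hS).aestronglyMeasurable,
    integral_withDensity_eq_integral_toReal_smul (by fun_prop) (by simp)]
  calc _ = ∫ y, (Metric.ball (0 : FourVector) ε ×ˢ Set.univ).indicator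
        (fun y : FourVector × Momentum × Direction =>
          collisionDensity p y.1 y.2 * φ (collisionTriple p y.1 y.2)) y
        ∂((volume : Measure FourVector).prod (shellMeasure.prod directionMeasure)) := by
        refine integral_congr_ae (Eventually.of_forall fun y => ?_)
        simp only [ENNReal.toReal_ofReal (collisionDensity_nonneg p y.1 y.2), smul_eq_mul]
        by_cases h0 : collisionDensity p y.1 y.2 = 0
        · simp [h0, Set.indicator]
        · have := conservationDefect_collisionTriple h0
          simp only [Set.indicator, Set.mem_ofPred_eq, this, Set.mem_prod, Set.mem_univ, and_true,
            mem_ball_zero_iff]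
          split_ifs <;> simp
    _ = _ := by
        rw [integral_indicator hB]
        rw [← Measure.prod_restrict, Measure.restrict_univ, integral_prod]
        · rfl
        · rwa [IntegrableOn, ← Measure.prod_restrict, Measure.restrict_univ] at hint

lemma integral_map_withDensity {X Y : Type*} [MeasurableSpace X] [MeasurableSpace Y]
    {μ : Measure X} {D : X → ℝ} (hD : Measurable D) (hD0 : ∀ x, 0 ≤ D x) {T : X → Y}
    (hT : Measurable T) {φ : Y → ℝ} (hφ : Measurable φ) :
    ∫ y, φ y ∂(Measure.map T (μ.withDensity (fun x => ENNReal.ofReal (D x))))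
      = ∫ x, D x * φ (T x) ∂μ := by
  rw [integral_map hT.aemeasurable hφ.aestronglyMeasurable,
    integral_withDensity_eq_integral_toReal_smul (by fun_prop) (by simp)]
  simp only [ENNReal.toReal_ofReal (hD0 _), smul_eq_mul]

lemma integral_explicitCollisionMeasure (p : Momentum) (hφ : Continuous φ) :
    ∫ x, φ x ∂(explicitCollisionMeasure p) = levelIntegral p φ 0 :=
  integral_map_withDensity ((measurable_collisionDensity p).comp measurable_prodMk_left)
    (collisionDensity_nonneg p 0) ((measurable_collisionTriple p).comp measurable_prodMk_left)
    hφ.measurable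

end

theorem isDeltaMeasure_explicitCollisionMeasure (p : Momentum) :
    IsDeltaMeasure tripleMeasure (conservationDefect p) (explicitCollisionMeasure p) := by
  refine ⟨inferInstance, fun φ hφ hc => ?_⟩
  rw [integral_explicitCollisionMeasure p hφ]
  have hint : IntegrableOn (levelIntegral p φ) (Metric.ball 0 1) := by
    have := integrableOn_collisionIntegrand p hφ hc
    rw [IntegrableOn, ← Measure.prod_restrict, Measure.restrict_univ] at this
    exact this.integral_prod_left
  refine (tendsto_ball_average volume (continuousAt_levelIntegral p hφ hc) one_pos
    measure_ball_lt_top hint).congr' ?_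
  filter_upwards [Ioo_mem_nhdsGT (zero_lt_one' ℝ)] with ε hε
  rw [setIntegral_conservationDefect_lt p hφ hc hε.2.le]

theorem collisionMeasure_eq (p : Momentum) :
    collisionMeasure p = explicitCollisionMeasure p := by
  have h : ∃ ν, IsDeltaMeasure tripleMeasure (conservationDefect p) ν :=
    ⟨_, isDeltaMeasure_explicitCollisionMeasure p⟩
  rw [collisionMeasure, deltaMeasure, dif_pos h]
  exact h.choose_spec.unique (isDeltaMeasure_explicitCollisionMeasure p)

/-! ### A uniform inverse-square-root integral over the unit ball -/

lemma lintegral_fin_three_mul {f₀ f₁ f₂ : ℝ → ℝ≥0∞} (h₀ : Measurable f₀) (h₁ : Measurable f₁)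
    (h₂ : Measurable f₂) :
    ∫⁻ x : Fin 3 → ℝ, f₀ (x 0) * (f₁ (x 1) * f₂ (x 2))
      = (∫⁻ t, f₀ t) * ((∫⁻ t, f₁ t) * ∫⁻ t, f₂ t) := by
  have e₃ := volume_preserving_piFinSuccAbove (fun _ : Fin 3 => ℝ) 0
  have e₂ := volume_preserving_finTwoArrow ℝ
  have s₃ := e₃.lintegral_comp_emb (MeasurableEquiv.measurableEmbedding _)
    (fun y => f₀ y.1 * (f₁ (y.2 0) * f₂ (y.2 1)))
  have s₂ := e₂.lintegral_comp_emb (MeasurableEquiv.measurableEmbedding _)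
    (fun y => f₁ y.1 * f₂ y.2)
  calc _ = _ := s₃
    _ = (∫⁻ t, f₀ t) * ∫⁻ y : Fin 2 → ℝ, f₁ (y 0) * f₂ (y 1) := by
      rw [Measure.volume_eq_prod, lintegral_prod_mul h₀.aemeasurable
        (by fun_prop : AEMeasurable (fun y : Fin 2 → ℝ => f₁ (y 0) * f₂ (y 1)) volume)]
    _ = (∫⁻ t, f₀ t) * ((∫⁻ t, f₁ t) * ∫⁻ t, f₂ t) := by
      congr 1
      refine Eq.trans s₂ ?_
      rw [Measure.volume_eq_prod, lintegral_prod_mul h₁.aemeasurable h₂.aemeasurable]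

/-- The function `|t|^{-1/2}`, cut off to `[-1, 1]`. -/
def invSqrtCutoff (t : ℝ) : ℝ≥0∞ :=
  (Set.Icc (-1) 1).indicator (fun t => (ENNReal.ofReal √|t|)⁻¹) t

@[fun_prop]
lemma measurable_invSqrtCutoff : Measurable invSqrtCutoff := by
  unfold invSqrtCutoff
  exact Measurable.indicator (by fun_prop) measurableSet_Icc

lemma lintegral_invSqrtCutoff_lt_top : ∫⁻ t, invSqrtCutoff t < ⊤ := by
  have h1 : ∫⁻ t in Set.Ioc (0 : ℝ) 1, (ENNReal.ofReal √|t|)⁻¹ < ⊤ := by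
    have hi : IntegrableOn (fun t : ℝ => t ^ (-1 / 2 : ℝ)) (Set.Ioc 0 1) := by
      have := intervalIntegral.intervalIntegrable_rpow' (a := 0) (b := 1)
        (r := (-1 / 2 : ℝ)) (by norm_num)
      rwa [intervalIntegrable_iff_integrableOn_Ioc_of_le zero_le_one] at this
    refine lt_of_eq_of_lt (setLIntegral_congr_fun measurableSet_Ioc fun t ht => ?_)
      hi.lintegral_lt_top
    have ht0 : 0 < t := ht.1
    simp only [abs_of_pos ht0]
    rw [← ENNReal.ofReal_inv_of_pos (Real.sqrt_pos.2 ht0), Real.sqrt_eq_rpow,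
      ← Real.rpow_neg ht0.le]
    norm_num
  have h2 : ∫⁻ t in Set.Ico (-1 : ℝ) 0, (ENNReal.ofReal √|t|)⁻¹
      = ∫⁻ t in Set.Ioc (0 : ℝ) 1, (ENNReal.ofReal √|t|)⁻¹ := by
    have := (Measure.measurePreserving_neg (volume : Measure ℝ)).setLIntegral_comp_preimage
      (s := Set.Ioc (0 : ℝ) 1) measurableSet_Ioc
      (f := fun t => (ENNReal.ofReal √|t|)⁻¹) (by fun_prop)
    simpa using this
  unfold invSqrtCutoff
  rw [lintegral_indicator measurableSet_Icc]
  have hsub : (Set.Icc (-1 : ℝ) 1) ⊆ (Set.Ico (-1 : ℝ) 0 ∪ {0}) ∪ Set.Ioc 0 1 := by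
    intro t ht
    rcases lt_trichotomy t 0 with h | h | h
    · exact Or.inl (Or.inl ⟨ht.1, h⟩)
    · exact Or.inl (Or.inr h)
    · exact Or.inr ⟨h, ht.2⟩
  calc _ ≤ _ := lintegral_mono_set hsub
    _ ≤ _ := lintegral_union_le _ _ _
    _ ≤ _ := add_le_add_left (lintegral_union_le _ _ _) _
    _ < ⊤ := by
      rw [h2, setLIntegral_measure_zero _ _ (by simp : volume ({0} : Set ℝ) = 0), add_zero]
      exact ENNReal.add_lt_top.2 ⟨h1, h1⟩

/-- A bound for the averaged inverse square root of a linear function on the sphere. -/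
def sphereConstant : ℝ≥0∞ :=
  (∫⁻ t, invSqrtCutoff t) * ((∫⁻ t, invSqrtCutoff t) * ∫⁻ t, (Set.Icc (-1 : ℝ) 1).indicator 1 t)

lemma sphereConstant_lt_top : sphereConstant < ⊤ := by
  refine ENNReal.mul_lt_top lintegral_invSqrtCutoff_lt_top
    (ENNReal.mul_lt_top lintegral_invSqrtCutoff_lt_top ?_)
  rw [lintegral_indicator_one measurableSet_Icc]
  exact measure_Icc_lt_top

/-- Putting w along axis 2 leaves axes 0 and 1 transverse, matching the factors of `sphereConstant`.
-/
lemma exists_orthonormalBasis_inner_eq (w : Momentum) :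
    ∃ b : OrthonormalBasis (Fin 3) ℝ Momentum, ∀ y, inner ℝ w y = ‖w‖ * b.repr y 2 := by
  by_cases hw : w = 0
  · exact ⟨EuclideanSpace.basisFun _ _, by simp [hw]⟩
  have hw' : ‖w‖ ≠ 0 := norm_ne_zero_iff.2 hw
  obtain ⟨b, hb⟩ := Orthonormal.exists_orthonormalBasis_extension_of_card_eq (𝕜 := ℝ)
    (E := Momentum) (ι := Fin 3) (by simp) (v := fun _ => ‖w‖⁻¹ • w) (s := {2})
    ⟨fun i => by simp [norm_smul, hw'], fun i j hij => absurd (Subsingleton.elim i j) hij⟩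
  refine ⟨b, fun y => ?_⟩
  rw [b.repr_apply_apply, hb 2 rfl, real_inner_smul_left]
  field_simp

/-- The right side is at least α(1 - |c|/n), and 2|a||b| ≤ a² + b² = n² - c² ≤ 2(n - |c|) for n ≤ 1.
Unlike a² + b², the product |a||b| splits the integral into one-dimensional ones, and the bound
survives m = α, where the denominator can vanish. -/
lemma sphere_denominator_ge {α m a b c n : ℝ} (hα : 0 ≤ α) (hm : 0 ≤ m) (hmα : m ≤ α)
    (hn : 0 < n) (hn1 : n ≤ 1) (hn2 : n ^ 2 = a ^ 2 + b ^ 2 + c ^ 2) :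
    α * (|a| * |b|) ≤ α + m * c / n := by
  have hc : |c| ≤ n := abs_le_of_sq_le_sq (by nlinarith [sq_nonneg a, sq_nonneg b]) hn.le
  have h1 : -(α * |c|) ≤ m * c := by
    have : -(m * |c|) ≤ m * c := by nlinarith [neg_abs_le c]
    nlinarith [abs_nonneg c]
  have h2 : 2 * (|a| * |b|) ≤ n ^ 2 - |c| ^ 2 := by
    rw [sq_abs]; nlinarith [sq_nonneg (|a| - |b|), sq_abs a, sq_abs b]
  have hab : 0 ≤ |a| * |b| := by positivity
  have h3 : |a| * |b| * n ≤ n - |c| := by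
    have h4 : n ^ 2 - |c| ^ 2 ≤ 2 * (n - |c|) := by nlinarith [abs_nonneg c]
    nlinarith
  rw [← sub_nonneg]
  have h5 : α + m * c / n - α * (|a| * |b|) = (α * n + m * c - α * (|a| * |b| * n)) / n := by
    field_simp
  rw [h5]
  apply div_nonneg _ hn.le
  nlinarith

lemma lintegral_ball_inv_sqrt_le {α : ℝ} (hα : 0 < α) {w : Momentum} (hw : ‖w‖ ≤ α) :
    ∫⁻ y in Metric.ball (0 : Momentum) 1, (ENNReal.ofReal √(α + inner ℝ w y / ‖y‖))⁻¹
      ≤ (ENNReal.ofReal √α)⁻¹ * sphereConstant := by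
  obtain ⟨b, hb⟩ := exists_orthonormalBasis_inner_eq w
  set K : (Fin 3 → ℝ) → ℝ≥0∞ := fun x =>
    invSqrtCutoff (x 0) * (invSqrtCutoff (x 1) * (Set.Icc (-1 : ℝ) 1).indicator 1 (x 2)) with hK
  have hone : Measurable ((Set.Icc (-1 : ℝ) 1).indicator (1 : ℝ → ℝ≥0∞)) :=
    measurable_one.indicator measurableSet_Icc
  have hKm : Measurable K := by fun_prop
  have hint : ∫⁻ y, K (b.repr y).ofLp = sphereConstant := by
    have s1 := b.measurePreserving_repr.lintegral_comp (f := fun y => K y.ofLp) (by fun_prop)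
    have s2 := (PiLp.volume_preserving_ofLp (Fin 3)).lintegral_comp hKm
    rw [s1, s2]
    exact lintegral_fin_three_mul measurable_invSqrtCutoff measurable_invSqrtCutoff hone
  have hpt : ∀ y ∈ Metric.ball (0 : Momentum) 1,
      (ENNReal.ofReal √(α + inner ℝ w y / ‖y‖))⁻¹
        ≤ (ENNReal.ofReal √α)⁻¹ * K (b.repr y).ofLp := by
    intro y hy
    have hy1 : ‖y‖ < 1 := by simpa using hy
    have hn2 : ‖y‖ ^ 2 = (b.repr y 0) ^ 2 + (b.repr y 1) ^ 2 + (b.repr y 2) ^ 2 := by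
      rw [← b.repr.norm_map y, EuclideanSpace.norm_sq_eq, Fin.sum_univ_three]
      simp
    have hmem : ∀ i, b.repr y i ∈ Set.Icc (-1 : ℝ) 1 := by
      intro i
      rw [Set.mem_Icc, ← abs_le]
      have := PiLp.norm_apply_le (b.repr y) i
      rw [b.repr.norm_map, Real.norm_eq_abs] at this
      linarith
    have hden : α * (|b.repr y 0| * |b.repr y 1|) ≤ α + inner ℝ w y / ‖y‖ := by
      by_cases h0 : y = 0
      · simp [h0, hα.le]
      · rw [hb]
        exact sphere_denominator_ge hα.le (norm_nonneg w) hw (norm_pos_iff.2 h0) hy1.le hn2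
    simp only [hK, invSqrtCutoff, Set.indicator_of_mem (hmem _), Pi.one_apply, mul_one]
    rw [← ENNReal.mul_inv (Or.inr ENNReal.ofReal_ne_top) (Or.inl ENNReal.ofReal_ne_top),
      ← ENNReal.ofReal_mul (by positivity), ← Real.sqrt_mul (by positivity),
      ← ENNReal.mul_inv (Or.inr ENNReal.ofReal_ne_top) (Or.inl ENNReal.ofReal_ne_top),
      ← ENNReal.ofReal_mul (by positivity), ← Real.sqrt_mul (by positivity)]
    exact ENNReal.inv_le_inv.2 (ENNReal.ofReal_le_ofReal (Real.sqrt_le_sqrt hden))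
  calc _ ≤ ∫⁻ y in Metric.ball (0 : Momentum) 1, (ENNReal.ofReal √α)⁻¹ * K (b.repr y).ofLp :=
        setLIntegral_mono' measurableSet_ball hpt
    _ ≤ ∫⁻ y, (ENNReal.ofReal √α)⁻¹ * K (b.repr y).ofLp := setLIntegral_le_lintegral _ _
    _ = _ := by rw [lintegral_const_mul _ (by fun_prop), hint]

/-! ### Angular average of the inverse relative momentum -/

/-- A linear change of variables on the sphere, for functions that are homogeneous of degree 0. -/
lemma lintegral_sphere_linear (L : Momentum →ₗ[ℝ] Momentum) (hL : LinearMap.det L ≠ 0)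
    {ψ : Momentum → ℝ≥0∞} (hψ : Measurable ψ) (hhom : ∀ r : ℝ, 0 < r → ∀ y, ψ (r • y) = ψ y) :
    ∫⁻ ω : Direction, ENNReal.ofReal ((‖L ω‖ ^ 3)⁻¹) * ψ (L ω) ∂directionMeasure
      = 3 * (ENNReal.ofReal |(LinearMap.det L)⁻¹| * ∫⁻ y in Metric.ball 0 1, ψ y) := by
  have hLm : Measurable L := L.continuous_of_finiteDimensional.measurable
  have hLinj : Function.Injective L := (LinearMap.equivOfDetNeZero L hL).injective
  set G : Momentum → ℝ≥0∞ := (Metric.ball 0 1).indicator ψ with hG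
  have hGm : Measurable G := hψ.indicator measurableSet_ball
  have h1 : ∫⁻ x, G (L x) = ENNReal.ofReal |(LinearMap.det L)⁻¹| *
      ∫⁻ y in Metric.ball 0 1, ψ y := by
    rw [← lintegral_map hGm hLm, Measure.map_linearMap_addHaar_eq_smul_addHaar _ hL,
      lintegral_smul_measure, hG, lintegral_indicator measurableSet_ball, smul_eq_mul]
  rw [← h1, lintegral_polar (by fun_prop), ← lintegral_const_mul' _ _ (by norm_num)]
  refine lintegral_congr fun ω => ?_
  have hpos : 0 < ‖L ω‖ := by
    rw [norm_pos_iff]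
    intro h0
    have : (ω : Momentum) = 0 := hLinj (by rw [h0, map_zero])
    have h := norm_direction ω
    rw [this, norm_zero] at h
    exact zero_ne_one h
  set ρ := ‖L ω‖⁻¹ with hρ
  have hρ0 : 0 < ρ := inv_pos.2 hpos
  -- The ray in direction ω lies in the preimage of the ball exactly for r < ρ, and ψ ∘ L is
  -- constant on it. The radial integral is ρ³/3, whence the factor 3.
  have h2 : ∀ r ∈ Set.Ioi (0 : ℝ), ENNReal.ofReal (r ^ 2) * G (L (r • (ω : Momentum)))
      = (Set.Iio ρ).indicator (fun r => ENNReal.ofReal (r ^ 2) * ψ (L ω)) r := by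
    intro r hr
    have hr : 0 < r := hr
    rw [map_smul, hG]
    have : r • L ω ∈ Metric.ball (0 : Momentum) 1 ↔ r ∈ Set.Iio ρ := by
      rw [mem_ball_zero_iff, norm_smul, Real.norm_of_nonneg hr.le, Set.mem_Iio, hρ,
        lt_inv_comm₀ hr hpos, inv_eq_one_div, lt_div_iff₀ hr, mul_comm]
    by_cases h : r ∈ Set.Iio ρ
    · rw [Set.indicator_of_mem h, Set.indicator_of_mem (this.2 h), hhom r hr]
    · rw [Set.indicator_of_notMem h, Set.indicator_of_notMem (fun h' => h (this.1 h')), mul_zero]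
  have h3 : ∫⁻ r in Set.Iio ρ ∩ Set.Ioi (0 : ℝ), ENNReal.ofReal (r ^ 2)
      = ENNReal.ofReal (ρ ^ 3 / 3) := by
    rw [Set.inter_comm, Set.Ioi_inter_Iio, Measure.restrict_congr_set Ioo_ae_eq_Ioc,
      ← ofReal_integral_eq_lintegral_ofReal
        ((intervalIntegrable_iff_integrableOn_Ioc_of_le hρ0.le).1
          ((continuous_pow 2).intervalIntegrable _ _))
        (Eventually.of_forall fun r => sq_nonneg r),
      ← intervalIntegral.integral_of_le hρ0.le]
    congr 1
    rw [integral_pow]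
    norm_num
  rw [setLIntegral_congr_fun measurableSet_Ioi h2, lintegral_indicator measurableSet_Iio,
    Measure.restrict_restrict measurableSet_Iio, lintegral_mul_const _ (by fun_prop), h3,
    ← mul_assoc, show (3 : ℝ≥0∞) = ENNReal.ofReal 3 by simp, ← ENNReal.ofReal_mul (by norm_num),
    hρ, inv_pow]
  congr 2
  ring

lemma lorentz_fourMomentum_sub (p q : Momentum) :
    lorentz (fourMomentum p - fourMomentum q) (fourMomentum p - fourMomentum q)
      = 2 * (energy p * energy q - inner ℝ p q - 1) := by
  have hp := energy_sq p
  have hq := energy_sq q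
  have := norm_sub_sq_real p q
  simp only [lorentz, fourMomentum, Prod.fst_sub, Prod.snd_sub, real_inner_self_eq_norm_sq]
  linear_combination this - hp - hq

lemma relMomentum_fourMomentum (p q : Momentum) :
    relMomentum (fourMomentum p) (fourMomentum q)
      = √(2 * (energy p * energy q - inner ℝ p q - 1)) := by
  rw [relMomentum, lorentz_fourMomentum_sub]

lemma lorentz_fourMomentum_sub_nonneg (p q : Momentum) :
    0 ≤ 2 * (energy p * energy q - inner ℝ p q - 1) := by
  linarith [one_add_norm_mul_norm_le p q, real_inner_le_norm p q]

lemma IsEnergyMomentum.eq_fourMomentum {a : FourVector} (ha : IsEnergyMomentum a) :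
    a = fourMomentum a.2 := by
  refine Prod.ext ?_ rfl
  obtain ⟨h1, h2⟩ := ha
  rw [lorentz, real_inner_self_eq_norm_sq] at h1
  exact (energy_eq_of_sq h2.le (by linarith)).symm

/-- The linear contraction by the factor `√(1 - |u|²)` in the direction of the velocity `u`. -/
def contraction (u : Momentum) : Momentum →ₗ[ℝ] Momentum :=
  LinearMap.transvection (innerₛₗ ℝ u) (-(1 + √(1 - ‖u‖ ^ 2))⁻¹ • u)

lemma contraction_apply (u x : Momentum) :
    contraction u x = x - ((1 + √(1 - ‖u‖ ^ 2))⁻¹ * inner ℝ u x) • u := by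
  simp only [contraction, LinearMap.transvection.apply, innerₛₗ_apply_apply]
  module

lemma contraction_coeff {u : Momentum} (hu : ‖u‖ ≤ 1) :
    (1 + √(1 - ‖u‖ ^ 2))⁻¹ * ‖u‖ ^ 2 = 1 - √(1 - ‖u‖ ^ 2) := by
  have h1 : 0 ≤ 1 - ‖u‖ ^ 2 := by nlinarith [norm_nonneg u]
  have h2 := Real.sq_sqrt h1
  have h3 := Real.sqrt_nonneg (1 - ‖u‖ ^ 2)
  rw [inv_mul_eq_iff_eq_mul₀ (by positivity)]
  linear_combination h2

lemma det_contraction {u : Momentum} (hu : ‖u‖ ≤ 1) :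
    LinearMap.det (contraction u) = √(1 - ‖u‖ ^ 2) := by
  rw [contraction, LinearMap.transvection.det, innerₛₗ_apply_apply, real_inner_smul_right,
    real_inner_self_eq_norm_sq]
  linarith [contraction_coeff hu]

/-- The contraction L is the symmetric square root of 1 - u uᵀ. For u = k/E and unit ω, E‖Lω‖ is
therefore the root in the denominator of `phaseDensity`. -/
lemma norm_contraction_sq {u : Momentum} (hu : ‖u‖ ≤ 1) (x : Momentum) :
    ‖contraction u x‖ ^ 2 = ‖x‖ ^ 2 - inner ℝ u x ^ 2 := by
  have h := contraction_coeff hu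
  have h3 := Real.sqrt_nonneg (1 - ‖u‖ ^ 2)
  have h4 : (1 + √(1 - ‖u‖ ^ 2))⁻¹ * (1 + √(1 - ‖u‖ ^ 2)) = 1 := inv_mul_cancel₀ (by positivity)
  rw [contraction_apply, norm_sub_sq_real, real_inner_smul_right, norm_smul, mul_pow,
    Real.norm_eq_abs, sq_abs, real_inner_comm u x]
  set κ := (1 + √(1 - ‖u‖ ^ 2))⁻¹
  linear_combination (inner ℝ u x) ^ 2 * (κ * h - h4)

/-- The contraction is symmetric and invertible, so w is its inverse applied to b, again a rank-one
perturbation of the identity. -/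
lemma exists_inner_contraction_eq {u : Momentum} (hu : ‖u‖ < 1) (b : Momentum) :
    ∃ w : Momentum, ∀ x, inner ℝ w (contraction u x) = inner ℝ b x := by
  have h := contraction_coeff hu.le
  have hδ : 0 < √(1 - ‖u‖ ^ 2) := Real.sqrt_pos.2 (by nlinarith [norm_nonneg u])
  set δ := √(1 - ‖u‖ ^ 2) with hδ'
  set κ := (1 + δ)⁻¹ with hκ
  refine ⟨b + (κ / δ * inner ℝ u b) • u, fun x => ?_⟩
  rw [contraction_apply, ← hδ', ← hκ, inner_sub_right, inner_add_left, inner_smul_right,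
    inner_add_left, real_inner_smul_left, real_inner_smul_left, real_inner_self_eq_norm_sq, real_inner_comm b u]
  field_simp
  linear_combination (-κ * inner ℝ u x * inner ℝ b u) * h

/-- Angular average of the inverse relative momentum over the pairs with a given total
four-momentum. -/
lemma lintegral_phaseDensity_div_relMomentum_le {P : FourVector} (hE : 0 < P.1)
    (hs : 4 < massSq P) (a : Momentum) :
    ∫⁻ ω : Direction, ENNReal.ofReal (phaseDensity P ω) *
        (ENNReal.ofReal (relMomentum (fourMomentum (outgoing P ω)) (fourMomentum a)))⁻¹
        ∂directionMeasure ≤ 3 * sphereConstant := by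
  obtain ⟨E, k⟩ := P
  simp only at hE
  set s := massSq (E, k) with hs_def
  set g := √(s - 4) with hg
  have hg0 : 0 < g := Real.sqrt_pos.2 (by linarith)
  have hgsq : g ^ 2 = s - 4 := Real.sq_sqrt (by linarith)
  have hsE : s = E ^ 2 - ‖k‖ ^ 2 := rfl
  set u : Momentum := E⁻¹ • k with hu_def
  have hun : ‖u‖ ^ 2 = ‖k‖ ^ 2 / E ^ 2 := by
    rw [hu_def, norm_smul, norm_inv, Real.norm_of_nonneg hE.le]; field_simp
  have hu1 : 1 - ‖u‖ ^ 2 = s / E ^ 2 := by rw [hun, hsE]; field_simp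
  have hu : ‖u‖ < 1 := by
    have : 0 < s / E ^ 2 := by positivity
    nlinarith [norm_nonneg u]
  set δ := √(1 - ‖u‖ ^ 2) with hδ
  have hδE : E * δ = √s := by
    rw [hδ, hu1, Real.sqrt_div (by linarith), Real.sqrt_sq hE.le]; field_simp
  have hδ0 : 0 < δ := Real.sqrt_pos.2 (by rw [hu1]; positivity)
  have hdet : LinearMap.det (contraction u) = δ := det_contraction hu.le
  have hdet0 : LinearMap.det (contraction u) ≠ 0 := by rw [hdet]; exact hδ0.ne'
  have hLpos : ∀ ω : Momentum, ‖ω‖ = 1 → 0 < ‖contraction u ω‖ := by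
    intro ω hω
    rw [norm_pos_iff]
    intro h0
    have : ω = 0 := (LinearMap.equivOfDetNeZero _ hdet0).injective (by
      change contraction u ω = contraction u 0
      rw [h0, map_zero])
    rw [this, norm_zero] at hω
    exact zero_ne_one hω
  have hD : ∀ ω : Momentum, ‖ω‖ = 1 → √(E ^ 2 - inner ℝ k ω ^ 2) = E * ‖contraction u ω‖ := by
    intro ω hω
    rw [← Real.sqrt_sq (by positivity : 0 ≤ E * ‖contraction u ω‖), mul_pow,
      norm_contraction_sq hu.le, hω, hu_def, real_inner_smul_left]
    congr 1
    field_simp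
  have hphase : ∀ ω : Momentum, ‖ω‖ = 1 →
      phaseDensity (E, k) ω = g / (2 * E) * (‖contraction u ω‖ ^ 3)⁻¹ := by
    intro ω hω
    have := hLpos ω hω
    simp only [phaseDensity, if_pos hE, hD ω hω]
    rw [← hs_def, ← hg]
    field_simp
  -- Here α = -P^μ a_μ - 2, and g(p, a)² becomes α + ⟨w, y⟩ in terms of the normalised y = Lω/‖Lω‖.
  -- The vector w represents the ω-dependent part after composition with the inverse of L.
  set α := E * energy a - inner ℝ k a - 2 with hα
  obtain ⟨w, hw⟩ := exists_inner_contraction_eq hu (g • (energy a • u - a))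
  have hrel : ∀ ω : Momentum, ‖ω‖ = 1 →
      2 * (energy (outgoing (E, k) ω) * energy a - inner ℝ (outgoing (E, k) ω) a - 1)
        = α + inner ℝ w (contraction u ω) / ‖contraction u ω‖ := by
    intro ω hω
    have hR : outgoingRadius (E, k) ω = g / (2 * ‖contraction u ω‖) := by
      have := hLpos ω hω
      simp only [outgoingRadius, hD ω hω]
      rw [← hs_def, ← hg]
      field_simp
    have := hLpos ω hω
    rw [energy_outgoing hω hE hs.le, hw, outgoing, hR, hα, hu_def]
    simp only [inner_add_left, inner_sub_left, real_inner_smul_left]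
    rw [real_inner_comm ω a]
    field_simp
    ring
  -- Every unit y is a normalised Lω, so g² ≥ 0 holds on the whole sphere. The choice y = -w/‖w‖
  -- later gives ‖w‖ ≤ α without computing ‖w‖.
  have hnonneg : ∀ y : Momentum, ‖y‖ = 1 → 0 ≤ α + inner ℝ w y := by
    intro y hy
    obtain ⟨x, hx⟩ := (LinearMap.equivOfDetNeZero _ hdet0).surjective y
    change contraction u x = y at hx
    have hx0 : ‖x‖ ≠ 0 := by
      intro h0
      rw [norm_eq_zero.1 h0, map_zero] at hx
      rw [← hx, norm_zero] at hy
      exact zero_ne_one hy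
    have hω : ‖‖x‖⁻¹ • x‖ = 1 := by rw [norm_smul]; simp [hx0]
    have h1 := hrel _ hω
    have h2 := lorentz_fourMomentum_sub_nonneg (outgoing (E, k) (‖x‖⁻¹ • x)) a
    rw [h1, map_smul, hx, norm_smul, hy, real_inner_smul_right] at h2
    simp only [norm_inv, norm_norm, mul_one] at h2
    rwa [mul_div_cancel_left₀ _ (inv_ne_zero hx0)] at h2
  have hsqrt : 2 ≤ √s := Real.le_sqrt_of_sq_le (by linarith)
  have hssq : √s ^ 2 = s := Real.sq_sqrt (by linarith)
  -- Reversed Cauchy–Schwarz for the timelike vectors P and a^μ: -P^μ a_μ ≥ √s.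
  have hαs : √s - 2 ≤ α := by
    have h1 : √s + ‖k‖ * ‖a‖ ≤ E * energy a := by
      refine (abs_le_of_sq_le_sq' ?_ (mul_pos hE (energy_pos a)).le).2
      rw [mul_pow, energy_sq, show E ^ 2 = √s ^ 2 + ‖k‖ ^ 2 by rw [hssq, hsE]; ring]
      nlinarith [sq_nonneg (‖k‖ - √s * ‖a‖)]
    linarith [real_inner_le_norm k a]
  have hg2 : g ^ 2 = (√s - 2) * (√s + 2) := by rw [hgsq]; linear_combination -hssq
  have hα0 : 0 < α := by
    have : 0 < √s - 2 := pos_of_mul_pos_left (hg2 ▸ pow_pos hg0 2) (by positivity)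
    linarith
  have hwα : ‖w‖ ≤ α := by
    by_cases hw0 : ‖w‖ = 0
    · rw [hw0]; exact hα0.le
    have h := hnonneg (-(‖w‖⁻¹ • w)) (by rw [norm_neg, norm_smul]; simp [hw0])
    rw [inner_neg_right, real_inner_smul_right, real_inner_self_eq_norm_sq] at h
    have : ‖w‖⁻¹ * ‖w‖ ^ 2 = ‖w‖ := by field_simp
    linarith
  set ψ : Momentum → ℝ≥0∞ := fun y => (ENNReal.ofReal √(α + inner ℝ w y / ‖y‖))⁻¹ with hψ
  have hψm : Measurable ψ := by fun_prop
  have hhom : ∀ r : ℝ, 0 < r → ∀ y, ψ (r • y) = ψ y := by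
    intro r hr y
    simp only [hψ, norm_smul, real_inner_smul_right, Real.norm_of_nonneg hr.le]
    rw [mul_div_mul_left _ _ hr.ne']
  -- Since Eδ = √s, the left side is g/(2√s√α). Moreover g² = (√s - 2)(√s + 2) ≤ αs, because √s + 2
  -- ≤ s for √s ≥ 2. This removes all dependence on P and a.
  have hsmall : g / (2 * E) * (δ⁻¹ * (√α)⁻¹) ≤ 1 := by
    have h1 : g ≤ √s * √α := by
      refine (abs_le_of_sq_le_sq' ?_ (by positivity)).2
      rw [mul_pow, Real.sq_sqrt hα0.le, hg2, hssq]
      have h3 : √s + 2 ≤ s := by nlinarith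
      calc (√s - 2) * (√s + 2) ≤ α * s := by gcongr
        _ = s * α := mul_comm _ _
    have hα1 := Real.sqrt_pos.2 hα0
    have h2 : g / (2 * E) * (δ⁻¹ * (√α)⁻¹) = g / (2 * (√s * √α)) := by
      rw [← hδE]; field_simp
    rw [h2, div_le_one (by positivity)]
    linarith [hg0]
  calc _ = ∫⁻ ω : Direction, ENNReal.ofReal (g / (2 * E)) *
          (ENNReal.ofReal ((‖contraction u ω‖ ^ 3)⁻¹) * ψ (contraction u ω)) ∂directionMeasure := by
        refine lintegral_congr fun ω => ?_
        have hω := norm_direction ω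
        rw [relMomentum_fourMomentum, hrel ω hω, hphase ω hω, ENNReal.ofReal_mul (by positivity),
          mul_assoc]
    _ = ENNReal.ofReal (g / (2 * E)) *
          (3 * (ENNReal.ofReal δ⁻¹ * ∫⁻ y in Metric.ball 0 1, ψ y)) := by
        rw [lintegral_const_mul' _ _ ENNReal.ofReal_ne_top,
          lintegral_sphere_linear _ hdet0 hψm hhom, hdet, abs_of_pos (inv_pos.2 hδ0)]
    _ ≤ ENNReal.ofReal (g / (2 * E)) *
          (3 * (ENNReal.ofReal δ⁻¹ * (ENNReal.ofReal (√α)⁻¹ * sphereConstant))) := by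
        gcongr
        rw [ENNReal.ofReal_inv_of_pos (Real.sqrt_pos.2 hα0)]
        exact lintegral_ball_inv_sqrt_le hα0 hwα
    _ = ENNReal.ofReal (g / (2 * E) * (δ⁻¹ * (√α)⁻¹)) * (3 * sphereConstant) := by
        rw [ENNReal.ofReal_mul (by positivity), ENNReal.ofReal_mul (by positivity)]
        ring
    _ ≤ 1 * (3 * sphereConstant) := by
        gcongr
        exact ENNReal.ofReal_le_one.2 hsmall
    _ = _ := one_mul _

/-! ### Bounding the gain operator by pair integrals -/

@[fun_prop]
lemma measurable_relMomentum : Measurable (fun z : FourVector × FourVector =>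
    relMomentum z.1 z.2) := by
  unfold relMomentum lorentz; fun_prop

@[fun_prop]
lemma measurable_sInv : Measurable (fun z : FourVector × FourVector => sInv z.1 z.2) := by
  unfold sInv lorentz; fun_prop

lemma sInv_eq_massSq (x y : FourVector) : sInv x y = massSq (x + y) := by
  rw [sInv, lorentz, massSq, real_inner_self_eq_norm_sq]; ring

lemma relMomentum_eq_sqrt_massSq (p q : Momentum) :
    relMomentum (fourMomentum p) (fourMomentum q)
      = √(massSq (fourMomentum p + fourMomentum q) - 4) := by
  rw [relMomentum_fourMomentum, massSq_fourMomentum_add]; ring_nf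

/-- g² = |p - q|² - (p⁰ - q⁰)², and the energy is a strict contraction because |p + q| < p⁰ + q⁰. -/
lemma relMomentum_pos {p q : Momentum} (h : p ≠ q) :
    0 < relMomentum (fourMomentum p) (fourMomentum q) := by
  rw [relMomentum_fourMomentum]
  apply Real.sqrt_pos.2
  have hp := energy_sq p
  have hq := energy_sq q
  have h1 : 0 < ‖p - q‖ := norm_pos_iff.2 (sub_ne_zero.2 h)
  have h2 := norm_sub_sq_real p q
  have h3 : (energy p - energy q) ^ 2 < ‖p - q‖ ^ 2 := by
    have h4 : (energy p - energy q) * (energy p + energy q) = inner ℝ (p - q) (p + q) := by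
      rw [inner_sub_left, inner_add_right, inner_add_right, real_inner_self_eq_norm_sq,
        real_inner_self_eq_norm_sq, real_inner_comm p q]
      linear_combination hp - hq
    have h5 : |energy p - energy q| * (energy p + energy q)
        < ‖p - q‖ * (energy p + energy q) := by
      calc |energy p - energy q| * (energy p + energy q)
          = |(energy p - energy q) * (energy p + energy q)| := by
            rw [abs_mul, abs_of_pos (add_pos (energy_pos p) (energy_pos q))]
        _ ≤ ‖p - q‖ * ‖p + q‖ := by rw [h4]; exact abs_real_inner_le_norm _ _
        _ < _ := by
            gcongr
            exact (norm_add_le p q).trans_lt (add_lt_add (norm_lt_energy p) (norm_lt_energy q))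
    have h6 := lt_of_mul_lt_mul_right h5 (add_pos (energy_pos p) (energy_pos q)).le
    rw [← sq_abs]
    gcongr
  nlinarith

/-- A nonnegative almost everywhere measurable function has a measurable majorant in its class. -/
lemma exists_measurable_ge_ae_eq {X : Type*} [MeasurableSpace X] {μ : Measure X} {f : X → ℝ≥0∞}
    (hf : AEMeasurable f μ) :
    ∃ F : X → ℝ≥0∞, Measurable F ∧ (∀ x, f x ≤ F x) ∧ F =ᵐ[μ] f := by
  classical
  set N := toMeasurable μ {x | f x ≠ hf.mk f x} with hN
  have hNm : MeasurableSet N := measurableSet_toMeasurable _ _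
  have hN0 : μ N = 0 := by rw [hN, measure_toMeasurable]; exact hf.ae_eq_mk
  have hmem : ∀ x, x ∉ N → f x = hf.mk f x := by
    intro x hx
    by_contra h
    exact hx (subset_toMeasurable _ _ h)
  refine ⟨N.piecewise (fun _ => ⊤) (hf.mk f), measurable_const.piecewise hNm hf.measurable_mk,
    fun x => ?_, ?_⟩
  · by_cases hx : x ∈ N
    · simp [hx]
    · simp [hx, hmem x hx]
  · filter_upwards [compl_mem_ae_iff.2 hN0] with x hx
    rw [Set.piecewise_eq_of_notMem _ _ _ hx, hmem x hx]

lemma lintegral_map_withDensity {X Y : Type*} [MeasurableSpace X] [MeasurableSpace Y]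
    {μ : Measure X} {D : X → ℝ} (hD : Measurable D) {T : X → Y}
    (hT : Measurable T) {G : Y → ℝ≥0∞} (hG : Measurable G) :
    ∫⁻ y, G y ∂(Measure.map T (μ.withDensity (fun x => ENNReal.ofReal (D x))))
      = ∫⁻ x, ENNReal.ofReal (D x) * G (T x) ∂μ := by
  rw [lintegral_map hG hT]
  exact lintegral_withDensity_eq_lintegral_mul _ hD.ennreal_ofReal (hG.comp hT)

lemma lintegral_explicitCollisionMeasure (p : Momentum)
    {G : Momentum × Momentum × Momentum → ℝ≥0∞} (hG : Measurable G) :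
    ∫⁻ x, G x ∂(explicitCollisionMeasure p) = ∫⁻ q, ∫⁻ ω : Direction,
      ENNReal.ofReal (phaseDensity (fourMomentum p + fourMomentum q) ω) *
        G (q, outgoing (fourMomentum p + fourMomentum q) ω,
          outgoing (fourMomentum p + fourMomentum q) (-(ω : Momentum)))
      ∂directionMeasure ∂shellMeasure := by
  have hdm : Measurable (collisionDensity p 0) := by unfold collisionDensity; fun_prop
  have hcm : Measurable (collisionTriple p 0) := by unfold collisionTriple; fun_prop
  rw [explicitCollisionMeasure, lintegral_map_withDensity hdm hcm hG]
  unfold collisionDensity collisionTriple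
  simp only [sub_zero]
  rw [lintegral_prod _ (by fun_prop)]

/-- The kernel bounds are available only for g > 0, so the set q = p has to be discarded. -/
lemma ae_fst_ne (p : Momentum) : ∀ᵐ x ∂(explicitCollisionMeasure p), x.1 ≠ p := by
  have hcm : Measurable (collisionTriple p 0) :=
    (measurable_collisionTriple p).comp measurable_prodMk_left
  have hS : MeasurableSet {x : Momentum × Momentum × Momentum | x.1 ≠ p} :=
    measurable_fst (measurableSet_singleton p).compl
  rw [explicitCollisionMeasure, ae_map_iff hcm.aemeasurable hS]
  refine (withDensity_absolutelyContinuous _ _).ae_le ?_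
  have h : ∀ᵐ q ∂shellMeasure, q ≠ p := by
    rw [ae_iff]
    have := shellMeasure_le {p} (measurableSet_singleton p)
    simpa using this
  exact Measure.quasiMeasurePreserving_fst.ae h

/-- The products `F(p') F(q')`, integrated over the pairs with total four-momentum `P`. -/
def pairIntegral (F : Momentum → ℝ≥0∞) (P : FourVector) : ℝ≥0∞ :=
  ∫⁻ ω : Direction, ENNReal.ofReal (phaseDensity P ω) *
    (F (outgoing P ω) * F (outgoing P (-(ω : Momentum)))) ∂directionMeasure

@[fun_prop]
lemma measurable_pairIntegral {F : Momentum → ℝ≥0∞} (hF : Measurable F) :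
    Measurable (pairIntegral F) := by
  unfold pairIntegral
  exact Measurable.lintegral_prod_right'
    (f := fun z : FourVector × Direction => ENNReal.ofReal (phaseDensity z.1 z.2) *
      (F (outgoing z.1 z.2) * F (outgoing z.1 (-(z.2 : Momentum))))) (by fun_prop)

/-- The factor `s σ(g, θ) / 2` with the upper bound `c g` in place of `σ(g, θ)`. -/
def kernelBound (c : ℝ) (p q : Momentum) : ℝ :=
  1 / 2 * sInv (fourMomentum p) (fourMomentum q) *
    (c * relMomentum (fourMomentum p) (fourMomentum q))

@[fun_prop]
lemma measurable_kernelBound (c : ℝ) :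
    Measurable (fun z : Momentum × Momentum => kernelBound c z.1 z.2) := by
  have h1 : Measurable (fun z : Momentum × Momentum =>
      sInv (fourMomentum z.1) (fourMomentum z.2)) :=
    measurable_sInv.comp (f := fun z : Momentum × Momentum =>
      (fourMomentum z.1, fourMomentum z.2)) (by fun_prop)
  have h2 : Measurable (fun z : Momentum × Momentum =>
      relMomentum (fourMomentum z.1) (fourMomentum z.2)) :=
    measurable_relMomentum.comp (f := fun z : Momentum × Momentum =>
      (fourMomentum z.1, fourMomentum z.2)) (by fun_prop)
  unfold kernelBound; fun_prop

/-- Measurability of `kernelBound` along measurable maps. -/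
@[fun_prop]
lemma Measurable.kernelBound {X : Type*} [MeasurableSpace X] (c : ℝ) {u v : X → Momentum}
    (hu : Measurable u) (hv : Measurable v) :
    Measurable (fun x => RelBoltzmann.kernelBound c (u x) (v x)) := by
  have h := (measurable_kernelBound c).comp (hu.prodMk hv)
  exact h

/-- As F dominates f at every point, no null set of f has to be followed through the collision
measure. The factors s and g depend on (p, q) only and leave the inner integral. -/
lemma gain_le {σ : ℝ → ℝ → ℝ} {c : ℝ}
    (hσ : ∀ g θ : ℝ, 0 < g → θ ∈ Set.Icc 0 Real.pi → σ g θ ≤ c * g)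
    {f : Momentum → ℝ} (hf : ∀ p, 0 ≤ f p) {F : Momentum → ℝ≥0∞} (hF : Measurable F)
    (hfF : ∀ p, ENNReal.ofReal (f p) ≤ F p) (p : Momentum) :
    gain σ f f p ≤ ENNReal.ofReal (1 / energy p) * ∫⁻ q, ENNReal.ofReal (kernelBound c p q) *
      pairIntegral F (fourMomentum p + fourMomentum q) ∂shellMeasure := by
  rw [gain, collisionMeasure_eq]
  refine mul_le_mul' le_rfl ?_
  calc _ ≤ ∫⁻ x, ENNReal.ofReal (kernelBound c p x.1) * (F x.2.1 * F x.2.2)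
        ∂(explicitCollisionMeasure p) := by
        refine lintegral_mono_ae ?_
        filter_upwards [ae_fst_ne p] with x hx
        have hs : 0 ≤ sInv (fourMomentum p) (fourMomentum x.1) := by
          rw [sInv_eq_massSq]; linarith [four_le_massSq_fourMomentum_add p x.1]
        have hg := relMomentum_pos hx.symm
        have hθ := hσ _ (scatteringAngle p x.1 x.2.2 x.2.1) hg
          ⟨Real.arccos_nonneg _, Real.arccos_le_pi _⟩
        calc _ ≤ ENNReal.ofReal (kernelBound c p x.1 * (f x.2.1 * f x.2.2)) := by
              apply ENNReal.ofReal_le_ofReal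
              rw [mul_assoc, mul_comm (f x.2.2)]
              have := hf x.2.1
              have := hf x.2.2
              unfold kernelBound
              gcongr
          _ ≤ ENNReal.ofReal (kernelBound c p x.1) * (F x.2.1 * F x.2.2) := by
              rw [ENNReal.ofReal_mul' (mul_nonneg (hf _) (hf _)), ENNReal.ofReal_mul (hf _)]
              gcongr <;> apply hfF
    _ = _ := by
        rw [lintegral_explicitCollisionMeasure p (by fun_prop)]
        refine lintegral_congr fun q => ?_
        rw [pairIntegral, ← lintegral_const_mul' _ _ ENNReal.ofReal_ne_top]
        refine lintegral_congr fun ω => ?_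
        ring

/-! ### Weights and the final estimate -/

/-- The weight `√E s^{3/2}` of a total four-momentum. -/
def totalWeight (P : FourVector) : ℝ := √P.1 * (massSq P * √(massSq P))

@[fun_prop]
lemma measurable_totalWeight : Measurable totalWeight := by
  unfold totalWeight; fun_prop

/-- From s ≤ 4p⁰q⁰ and E ≤ 2p⁰q⁰ one gets √(Es) ≤ √8 p⁰q⁰ ≤ 3p⁰q⁰; the constant is 4 · 3. -/
lemma totalWeight_fourMomentum_add_le (p q : Momentum) :
    totalWeight (fourMomentum p + fourMomentum q) ≤ 12 * (energy p ^ 2 * energy q ^ 2) := by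
  have hs4 := four_le_massSq_fourMomentum_add p q
  have hs : massSq (fourMomentum p + fourMomentum q) ≤ 4 * (energy p * energy q) := by
    rw [massSq_fourMomentum_add]
    have h1 := one_add_norm_mul_norm_le p q
    have h2 := neg_le_of_abs_le (abs_real_inner_le_norm p q)
    linarith
  have hp := one_le_energy p
  have hq := one_le_energy q
  set s := massSq (fourMomentum p + fourMomentum q)
  have hE : (fourMomentum p + fourMomentum q).1 = energy p + energy q := rfl
  have h3 : √(energy p + energy q) * √s ≤ 3 * (energy p * energy q) := by
    rw [← Real.sqrt_mul (by linarith)]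
    apply Real.sqrt_le_iff.2 ⟨by positivity, ?_⟩
    have h4 : energy p + energy q ≤ 2 * (energy p * energy q) := by nlinarith
    calc (energy p + energy q) * s ≤ 2 * (energy p * energy q) * (4 * (energy p * energy q)) := by
          gcongr
      _ ≤ _ := by nlinarith [sq_nonneg (energy p * energy q)]
  change √(fourMomentum p + fourMomentum q).1 * (s * √s) ≤ _
  rw [hE]
  calc √(energy p + energy q) * (s * √s) = s * (√(energy p + energy q) * √s) := by ring
    _ ≤ 4 * (energy p * energy q) * (3 * (energy p * energy q)) := by gcongr
    _ = _ := by ring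

/-- The weight `(p⁰)^{1/2} / g(p^μ, a^μ)`. -/
def potentialWeight (a p : Momentum) : ℝ≥0∞ :=
  ENNReal.ofReal √(energy p) / ENNReal.ofReal (relMomentum (fourMomentum p) (fourMomentum a))

@[fun_prop]
lemma measurable_potentialWeight (a : Momentum) : Measurable (potentialWeight a) := by
  have h2 : Measurable (fun p : Momentum => relMomentum (fourMomentum p) (fourMomentum a)) :=
    measurable_relMomentum.comp (f := fun p : Momentum => (fourMomentum p, fourMomentum a))
      (by fun_prop)
  have h3 := continuous_energy.measurable
  unfold potentialWeight; fun_prop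

/-- For a pair with total P, both s and g are functions of P and each energy is at most E. Only
1/g(p, a) stays under the angular integral. -/
lemma lintegral_potentialWeight_le {c : ℝ} (hc : 0 ≤ c) (a : Momentum) (P : FourVector) :
    ∫⁻ ω : Direction, ENNReal.ofReal (phaseDensity P ω) *
        (potentialWeight a (outgoing P ω) *
          ENNReal.ofReal (kernelBound c (outgoing P ω) (outgoing P (-(ω : Momentum)))))
        ∂directionMeasure
      ≤ ENNReal.ofReal (c / 2 * totalWeight P) * (3 * sphereConstant) := by
  by_cases hP : 0 < P.1 ∧ 4 < massSq P
  swap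
  · have h0 : ∀ ω : Direction, phaseDensity P ω = 0 := fun ω => by
      by_contra h; exact hP (pos_of_phaseDensity_ne_zero h)
    simp [h0]
  obtain ⟨hE, hs⟩ := hP
  have hpt : ∀ ω : Direction, potentialWeight a (outgoing P ω) *
      ENNReal.ofReal (kernelBound c (outgoing P ω) (outgoing P (-(ω : Momentum)))) ≤
      ENNReal.ofReal (c / 2 * totalWeight P) *
        (ENNReal.ofReal (relMomentum (fourMomentum (outgoing P ω)) (fourMomentum a)))⁻¹ := by
    intro ω
    have hsum := fourMomentum_outgoing_add (norm_direction ω) hE hs.le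
    have hle : energy (outgoing P ω) ≤ P.1 := by
      have := congrArg Prod.fst hsum
      simp only [fourMomentum, Prod.fst_add] at this
      linarith [energy_pos (outgoing P (-(ω : Momentum)))]
    rw [kernelBound, sInv_eq_massSq, relMomentum_eq_sqrt_massSq _ (outgoing P (-_)), hsum,
      potentialWeight, div_eq_mul_inv, mul_right_comm, ← ENNReal.ofReal_mul (by positivity)]
    refine mul_le_mul' (ENNReal.ofReal_le_ofReal ?_) le_rfl
    unfold totalWeight
    calc √(energy (outgoing P ω)) * (1 / 2 * massSq P * (c * √(massSq P - 4)))
        ≤ √P.1 * (1 / 2 * massSq P * (c * √(massSq P))) := by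
          gcongr
          linarith
      _ = _ := by ring
  calc _ ≤ ∫⁻ ω : Direction, ENNReal.ofReal (c / 2 * totalWeight P) *
          (ENNReal.ofReal (phaseDensity P ω) *
          (ENNReal.ofReal (relMomentum (fourMomentum (outgoing P ω)) (fourMomentum a)))⁻¹)
          ∂directionMeasure := by
        refine lintegral_mono fun ω => ?_
        rw [mul_left_comm (ENNReal.ofReal (c / 2 * totalWeight P))]
        exact mul_le_mul' le_rfl (hpt ω)
    _ ≤ _ := by
        rw [lintegral_const_mul' _ _ ENNReal.ofReal_ne_top]
        gcongr
        exact lintegral_phaseDensity_div_relMomentum_le hE hs a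

/-- A function of the total four-momentum may be evaluated before or after disintegration. -/
lemma lintegral_shellMeasure_prod_mul {h : Momentum × Momentum → ℝ≥0∞} (hh : Measurable h)
    {m : FourVector → ℝ≥0∞} (hm : Measurable m) :
    ∫⁻ x, h x * m (fourMomentum x.1 + fourMomentum x.2) ∂(shellMeasure.prod shellMeasure) =
      ∫⁻ P : FourVector, (∫⁻ ω : Direction, ENNReal.ofReal (phaseDensity P ω) *
        h (outgoing P ω, outgoing P (-(ω : Momentum))) ∂directionMeasure) * m P := by
  rw [lintegral_shellMeasure_prod (by fun_prop)]
  refine lintegral_congr fun P => ?_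
  rw [← lintegral_mul_const _ (by fun_prop)]
  refine lintegral_congr fun ω => ?_
  by_cases h0 : phaseDensity P ω = 0
  · simp [h0]
  obtain ⟨hE, hs⟩ := pos_of_phaseDensity_ne_zero h0
  rw [fourMomentum_outgoing_add (norm_direction ω) hE hs.le, mul_assoc]

/-- The disintegration is undone: the weight (p⁰q⁰)² against dp/p⁰ dq/q⁰ leaves one power of energy
per particle, the L¹₁ weight. -/
lemma lintegral_totalWeight_mul_le {F : Momentum → ℝ≥0∞} (hF : Measurable F) :
    ∫⁻ P, pairIntegral F P * ENNReal.ofReal (totalWeight P)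
      ≤ 12 * (∫⁻ p, ENNReal.ofReal (energy p) * F p) ^ 2 := by
  have hen := continuous_energy.measurable
  have hsq : ∫⁻ p, ENNReal.ofReal (energy p ^ 2) * F p ∂shellMeasure
      = ∫⁻ p, ENNReal.ofReal (energy p) * F p := by
    rw [lintegral_shellMeasure (by fun_prop)]
    refine lintegral_congr fun p => ?_
    have := energy_pos p
    rw [← mul_assoc, ← ENNReal.ofReal_mul (by positivity)]
    congr 2
    field_simp
  have h1 := lintegral_shellMeasure_prod_mul (h := fun x => F x.1 * F x.2) (by fun_prop)
    (m := fun P => ENNReal.ofReal (totalWeight P)) (by fun_prop)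
  calc _ = _ := h1.symm
    _ ≤ ∫⁻ x, 12 * ((ENNReal.ofReal (energy x.1 ^ 2) * F x.1) *
          (ENNReal.ofReal (energy x.2 ^ 2) * F x.2)) ∂(shellMeasure.prod shellMeasure) := by
        refine lintegral_mono fun x => ?_
        calc F x.1 * F x.2 * ENNReal.ofReal (totalWeight (fourMomentum x.1 + fourMomentum x.2))
            ≤ F x.1 * F x.2 * ENNReal.ofReal (12 * (energy x.1 ^ 2 * energy x.2 ^ 2)) := by
              gcongr
              exact totalWeight_fourMomentum_add_le _ _
          _ = _ := by
              rw [ENNReal.ofReal_mul (by norm_num), ENNReal.ofReal_mul (by positivity),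
                ENNReal.ofReal_ofNat]
              ring
    _ = _ := by
        rw [lintegral_const_mul _ (by fun_prop),
          lintegral_prod_mul (f := fun p => ENNReal.ofReal (energy p ^ 2) * F p)
            (g := fun p => ENNReal.ofReal (energy p ^ 2) * F p) (by fun_prop) (by fun_prop),
          hsq, sq]

lemma lintegral_potentialWeight_mul_gain_le {σ : ℝ → ℝ → ℝ} {c : ℝ} (hc : 0 ≤ c)
    (hσ : ∀ g θ : ℝ, 0 < g → θ ∈ Set.Icc 0 Real.pi → σ g θ ≤ c * g)
    {f : Momentum → ℝ} (hf : ∀ p, 0 ≤ f p) {F : Momentum → ℝ≥0∞} (hF : Measurable F)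
    (hfF : ∀ p, ENNReal.ofReal (f p) ≤ F p) (a : Momentum) :
    ∫⁻ p, potentialWeight a p * gain σ f f p ≤
      ENNReal.ofReal (c / 2) * (3 * sphereConstant) *
        (12 * (∫⁻ p, ENNReal.ofReal (energy p) * F p) ^ 2) := by
  have hpair := measurable_pairIntegral hF
  have hmeas : Measurable (fun x : Momentum × Momentum =>
      potentialWeight a x.1 * ENNReal.ofReal (kernelBound c x.1 x.2)) := by fun_prop
  have hmeas2 : Measurable (fun x : Momentum × Momentum =>
      potentialWeight a x.1 * ENNReal.ofReal (kernelBound c x.1 x.2) *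
        pairIntegral F (fourMomentum x.1 + fourMomentum x.2)) := by fun_prop
  calc ∫⁻ p, potentialWeight a p * gain σ f f p
      ≤ ∫⁻ p, ENNReal.ofReal (1 / energy p) * ∫⁻ q,
          potentialWeight a p * ENNReal.ofReal (kernelBound c p q) *
          pairIntegral F (fourMomentum p + fourMomentum q) ∂shellMeasure := by
        refine lintegral_mono fun p => ?_
        simp only [mul_assoc]
        rw [lintegral_const_mul _ (by fun_prop), mul_left_comm]
        gcongr
        exact gain_le hσ hf hF hfF p
    _ = ∫⁻ x, potentialWeight a x.1 * ENNReal.ofReal (kernelBound c x.1 x.2) *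
          pairIntegral F (fourMomentum x.1 + fourMomentum x.2)
          ∂(shellMeasure.prod shellMeasure) := by
        rw [lintegral_prod _ hmeas2.aemeasurable, lintegral_shellMeasure
          hmeas2.lintegral_prod_right']
    -- The pair integral depends on (p, q) only through P, so it factors out of the angular integral
    -- over the pairs (p, q).
    _ = _ := lintegral_shellMeasure_prod_mul hmeas hpair
    _ ≤ ∫⁻ P, ENNReal.ofReal (c / 2) * (3 * sphereConstant) *
          (pairIntegral F P * ENNReal.ofReal (totalWeight P)) := by
        refine lintegral_mono fun P => ?_
        calc _ ≤ ENNReal.ofReal (c / 2 * totalWeight P) * (3 * sphereConstant) *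
              pairIntegral F P := by
              gcongr
              exact lintegral_potentialWeight_le hc a P
          _ = _ := by rw [ENNReal.ofReal_mul (by positivity)]; ring
    _ ≤ _ := by
        rw [lintegral_const_mul _ (by fun_prop)]
        gcongr
        exact lintegral_totalWeight_mul_le hF

end

end RelBoltzmann

open RelBoltzmann
theorem proposition3p2 :
    -- the measure containing the four-dimensional delta function in the gain operator makes sense
    (∀ p : Momentum, ∃! ν : Measure (Momentum × Momentum × Momentum),
      IsDeltaMeasure tripleMeasure (conservationDefect p) ν) ∧
    -- the estimate; the constant depends only on the constants in the bounds for the kernel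
    ∀ c₁ c₂ : ℝ, 0 < c₁ → 0 < c₂ →
      ∃ C : ℝ, 0 < C ∧
        ∀ σ : ℝ → ℝ → ℝ, Measurable (Function.uncurry σ) →
          (∀ g θ : ℝ, 0 < g → θ ∈ Set.Icc 0 Real.pi → c₁ * g ≤ σ g θ ∧ σ g θ ≤ c₂ * g) →
          ∀ f : Momentum → ℝ, (∀ p, 0 ≤ f p) → MemWeightedL1 1 f →
            ∀ a : FourVector, IsEnergyMomentum a →
              ∫⁻ p : Momentum,
                  ENNReal.ofReal (Real.sqrt (energy p)) /
                    ENNReal.ofReal (relMomentum (fourMomentum p) a) * gain σ f f p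
                ≤ ENNReal.ofReal (C * Real.sqrt a.1) * weightedL1Norm 1 f ^ 2 := by
  refine ⟨fun p => ⟨explicitCollisionMeasure p, isDeltaMeasure_explicitCollisionMeasure p,
    fun ν hν => hν.unique (isDeltaMeasure_explicitCollisionMeasure p)⟩, ?_⟩
  intro c₁ c₂ _ hc₂
  have hK := sphereConstant_lt_top
  -- The summand 1 secures positivity without a lower bound on `sphereConstant`.
  refine ⟨c₂ / 2 * (3 * sphereConstant.toReal) * 12 + 1, by positivity, ?_⟩
  intro σ _ hσ f hf hfm a ha
  -- A measurable majorant in the class of f has the same norm and dominates f everywhere, as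
  -- `gain_le` requires.
  obtain ⟨F, hF, hfF, hFf⟩ := exists_measurable_ge_ae_eq hfm.1.ennreal_ofReal
  have hnorm : ∫⁻ p, ENNReal.ofReal (energy p) * F p = weightedL1Norm 1 f := by
    refine lintegral_congr_ae ?_
    filter_upwards [hFf] with p hp
    rw [hp, Real.rpow_one, abs_of_nonneg (hf p), ENNReal.ofReal_mul (energy_pos p).le]
  have ha1 : 1 ≤ √a.1 := by
    rw [ha.eq_fourMomentum, Real.one_le_sqrt]
    exact one_le_energy _
  have hmain := lintegral_potentialWeight_mul_gain_le hc₂.le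
    (fun g θ hg hθ => (hσ g θ hg hθ).2) hf hF hfF a.2
  rw [hnorm] at hmain
  simp only [potentialWeight, ← ha.eq_fourMomentum] at hmain
  refine hmain.trans ?_
  rw [← mul_assoc]
  gcongr
  calc ENNReal.ofReal (c₂ / 2) * (3 * sphereConstant) * 12
      = ENNReal.ofReal (c₂ / 2 * (3 * sphereConstant.toReal) * 12) := by
        rw [ENNReal.ofReal_mul (by positivity), ENNReal.ofReal_mul (by positivity),
          ENNReal.ofReal_mul (by norm_num), ENNReal.ofReal_toReal hK.ne, ENNReal.ofReal_ofNat,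
          ENNReal.ofReal_ofNat]
    _ ≤ _ := by
        apply ENNReal.ofReal_le_ofReal
        have : 0 ≤ c₂ / 2 * (3 * sphereConstant.toReal) * 12 := by positivity
        nlinarith
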